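/- Let $N\ge 1$ and $k$ be integers, and let $\Gamma_0(N)=\{\begin{pmatrix}a&b\\c&d\end{pmatrix}\in \mathrm{SL}_2(\mathbb Z): N\mid c\}$ act on $\mathbb H$ and on $\mathbb Q\cup\{i\infty\}$ by Möbius transformations. For $f:\mathbb H\to\mathbb C$ and $\sigma=\begin{pmatrix}a&b\\c&d\end{pmatrix}\in \mathrm{SL}_2(\mathbb Z)$ put $(f|_k\sigma)(\tau)=(c\tau+d)^{-k}f(\sigma\tau)$. For a cusp $\rho\in\mathcal C_N:=\Gamma_0(N)\backslash(\mathbb Q\cup\{i\infty\})$ choose $\sigma_\rho\in\mathrm{SL}_2(\mathbb Z)$ such that $\sigma_\rho(i\infty)$ represents $\rho$, and let the width $\ell_\rho$ be the least integer $h>0$ with $\sigma_\rho\begin{pmatrix}1&h\\0&1\end{pmatrix}\sigma_\rho^{-1}\in\Gamma_0(N)$. Let $f$ be a meromorphic modular form of weight $k$ on $\Gamma_0(N)$ that is not identically zero; that is, $f$ is meromorphic on $\mathbb H$, $f|_k\gamma=f$ for all $\gamma\in\Gamma_0(N)$, and $f$ is meromorphic at all cusps, so that for every cusp $\rho$ and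 $\mathrm{Im}\,\tau$ large $$(f|_k\sigma_\rho)(\tau)=\sum_{n\ge \mathrm{ord}_\rho(f)}c_{\rho,n}\,e^{2\pi i n\tau/\ell_\rho},\qquad c_{\rho,\mathrm{ord}_\rho(f)}\ne 0,$$ which defines the integer $\mathrm{ord}_\rho(f)$. For $z\in\mathbb H$ let $\mathrm{ord}_z(f)$ be the order of $f$ at $z$, and let $\omega_z$ be the order of the stabilizer of $z$ in $\Gamma_0(N)/\{\pm I\}$. Let $\mathrm{vol}(\Gamma_0(N)\backslash\mathbb H)$ be the area, for the measure $du\,dv/v^2$ ($\tau=u+iv$), of a fundamental domain for the action of $\Gamma_0(N)/\{\pm I\}$ on $\mathbb H$. Then $\mathcal C_N$ is finite, $\mathrm{ord}_z(f)\neq 0$ for only finitely many $z\in\Gamma_0(N)\backslash\mathbb H$, and $$\sum_{z\in\Gamma_0(N)\backslash\mathbb H}\frac{\mathrm{ord}_z(f)}{\omega_z}+\sum_{\rho\in\mathcal C_N}\mathrm{ord}_\rho(f)=\frac k2\cdot\frac{\mathrm{vol}(\Gamma_0(N)\backslash\mathbb H)}{2\pi}=\frac{k}{12}\,[\mathrm{SL}_2(\mathbb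 Z):\Gamma_0(N)],$$ for any choice of the representatives $z$ and of the matrices $\sigma_\rho$. -/

import Mathlib

open UpperHalfPlane CongruenceSubgroup ModularForm
open scoped MatrixGroups Real

noncomputable section

namespace ValenceFormula

/-- The quotient `Γ₀(N) / {±I}`, realised as the image of `Γ₀(N)` in `PGL(2, ℝ)`
(the kernel of `SL(2, ℤ) → PGL(2, ℝ)` is `{±I}`), which acts on `ℍ` by Möbius transformations. -/
def Gamma0Bar (N : ℕ) : Subgroup PGL(2, ℝ) :=
  (Gamma0 N).map (Matrix.ProjGenLinGroup.mk.comp (Matrix.SpecialLinearGroup.mapGL ℝ))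

/-- `ω_z`: the order of the stabilizer of `z` in `Γ₀(N) / {±I}`. -/
def stabOrder (N : ℕ) (z : ℍ) : ℕ := Nat.card (MulAction.stabilizer (Gamma0Bar N) z)

/-- The orbit space `Γ₀(N) \ ℍ`. -/
abbrev OpenModularCurve (N : ℕ) : Type := MulAction.orbitRel.Quotient (Gamma0 N) ℍ

/-- The area of `Γ₀(N) \ ℍ` for the hyperbolic measure `du dv / v²`: the measure of a fundamental
domain for the action of `Γ₀(N) / {±I}` on `ℍ`. -/
def hyperbolicVol (N : ℕ) : ℝ :=
  (MeasureTheory.covolume (Gamma0Bar N) ℍ MeasureTheory.volume).toReal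

/-- The set of cusps `Γ₀(N) \ (ℚ ∪ {i∞})`. -/
abbrev CuspSet (N : ℕ) : Type :=
  MulAction.orbitRel.Quotient
    ((Gamma0 N).map (Matrix.SpecialLinearGroup.mapGL ℚ)) (OnePoint ℚ)

/-- The cusp represented by `σ (i∞)`. -/
def cuspOf (N : ℕ) (σ : SL(2, ℤ)) : CuspSet N :=
  Quotient.mk _ (Matrix.SpecialLinearGroup.mapGL ℚ σ • (OnePoint.infty : OnePoint ℚ))

/-- The width `ℓ` of the cusp `σ (i∞)` of `Γ₀(N)`: the least `h > 0` such that
`σ [1, h; 0, 1] σ⁻¹ ∈ Γ₀(N)`. -/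
def cuspWidth (N : ℕ) (σ : SL(2, ℤ)) : ℕ :=
  sInf {h : ℕ | 0 < h ∧ σ * ModularGroup.T ^ h * σ⁻¹ ∈ Gamma0 N}

/-- The expansion of `f` at the cusp `σ (i∞)`: the function `F` of the local parameter
`q^{1/ℓ} = exp(2πiτ/ℓ)` with `(f ∣[k] σ)(τ) = F(q^{1/ℓ})`. -/
def cuspExpansion (N : ℕ) (k : ℤ) (f : ℍ → ℂ) (σ : SL(2, ℤ)) : ℂ → ℂ :=
  UpperHalfPlane.cuspFunction (cuspWidth N σ : ℝ) (f ∣[k] σ)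

/-- `f` is a meromorphic modular form of weight `k` on `Γ₀(N)`. The values of `f` at its poles are
irrelevant below, since all orders are computed on punctured neighbourhoods. -/
structure IsMeromorphicModularForm (N : ℕ) (k : ℤ) (f : ℍ → ℂ) : Prop where
  slash_eq : ∀ γ ∈ Gamma0 N, f ∣[k] γ = f
  meromorphic : ∀ z : ℍ, MeromorphicAt (f ∘ ofComplex) (z : ℂ)
  meromorphic_cusp : ∀ σ : SL(2, ℤ), MeromorphicAt (cuspExpansion N k f σ) 0

/-- `f` is not the zero meromorphic function: for some point `z` of `ℍ`, the function `f` does not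
vanish identically on any punctured neighbourhood of `z`. -/
def IsNonzero (f : ℍ → ℂ) : Prop :=
  ∃ z : ℍ, meromorphicOrderAt (f ∘ ofComplex) (z : ℂ) ≠ ⊤

/-- `ord_z(f)`, the order of `f` at a point `z` of `ℍ`. -/
def ordAt (f : ℍ → ℂ) (z : ℍ) : ℤ :=
  (meromorphicOrderAt (f ∘ ofComplex) (z : ℂ)).untop₀

/-- `ord_ρ(f)` for the cusp `ρ = σ (i∞)`: the least exponent `n` with nonzero coefficient in
`(f ∣[k] σ)(τ) = ∑ c_n q^{n/ℓ}`. -/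
def ordAtCusp (N : ℕ) (k : ℤ) (f : ℍ → ℂ) (σ : SL(2, ℤ)) : ℤ :=
  (meromorphicOrderAt (cuspExpansion N k f σ) 0).untop₀

end ValenceFormula

end

open ValenceFormula

noncomputable section

namespace ValenceFormula

open Filter Topology Function EisensteinSeries Derivative
open scoped Manifold

-- The formula is reduced to level one by a norm. The product `F` of the translates `f ∣[k] g⁻¹`
-- over the cosets `gΓ₀(N)` has weight `k` times the index for the full modular group. Its order at
-- a point is the sum of the orders of `f` at the translates, and its exponent at `i∞` is the sum of
-- the ratios order/width. Regrouping is orbit counting: `ncard_cosets_mul_card_stabilizer` turns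
-- level-one stabilizers into those of `Γ₀(N)`, and by `ncard_setOf_cuspOf_eq` a cusp of width `ℓ`
-- accounts for `ℓ` cosets, each contributing order/`ℓ`.
--
-- Level one uses no contour integral. Multiplying `F ^ 12 * Δ ^ (-K)` by suitable powers of `j -
-- j(s)` removes every zero and pole in `ℍ` and leaves weight zero. If the exponent at `i∞` were
-- positive, this would be a holomorphic form of weight zero, hence constant, vanishing at the cusp;
-- the inverse excludes a negative exponent. That the exponent is zero is the valence formula.
--
-- This needs two facts about `j`: it separates orbits, and its ramification index at `z` is half
-- the order of the stabilizer in `SL(2, ℤ)`. Both rest on `j' = c E₄² E₆ / Δ` with `c ≠ 0`, which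
-- holds because the Rankin–Cohen bracket of `E₄` and `E₆` is a cusp form of weight 12. Separation
-- of orbits is a connectedness argument on `ℂ` minus `{0, 1728}`, and ramification follows by
-- comparing orders in the derivative formula.
--
-- The area is the index times `π / 3`, since almost all of a fundamental domain is a disjoint union
-- of translates of the interior of the standard one.

local notation "𝕢" => Function.Periodic.qParam

/-! ### The Rankin–Cohen bracket of `E₄` and `E₆`. -/

section Derivatives

lemma E4_slash (γ : SL(2, ℤ)) : (E₄ : ℍ → ℂ) ∣[(4 : ℤ)] γ = E₄ :=
  SlashInvariantFormClass.slash_action_eq E₄ _ ⟨γ, rfl⟩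

lemma E6_slash (γ : SL(2, ℤ)) : (E₆ : ℍ → ℂ) ∣[(6 : ℤ)] γ = E₆ :=
  SlashInvariantFormClass.slash_action_eq E₆ _ ⟨γ, rfl⟩

lemma discriminant_slash (γ : SL(2, ℤ)) :
    ModularForm.discriminant ∣[(12 : ℤ)] γ = ModularForm.discriminant :=
  SlashInvariantFormClass.slash_action_eq CuspForm.discriminant _ ⟨γ, rfl⟩

lemma apply_smul_of_slash_eq {f g : ℍ → ℂ} {k : ℤ} {γ : SL(2, ℤ)} (h : f ∣[k] γ = g) (z : ℍ) :
    f (γ • z) = g z * denom γ z ^ k := by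
  have := congrFun h z
  rwa [ModularForm.SL_slash_apply, zpow_neg,
    mul_inv_eq_iff_eq_mul₀ (zpow_ne_zero _ (denom_ne_zero γ z))] at this

/-- In terms of `q = exp(2πiz)`, the normalised derivative is `q d/dq`. -/
lemma normalizedDeriv_eq_qParam_mul_deriv_cuspFunction {k : ℤ} (f : ModularForm 𝒮ℒ k) (z : ℍ) :
    normalizedDerivOfComplex f z = 𝕢 1 z * deriv (cuspFunction 1 f) (𝕢 1 z) := by
  have hev : ((f : ℍ → ℂ) ∘ ofComplex) =ᶠ[𝓝 (z : ℂ)] fun w ↦ cuspFunction 1 f (𝕢 1 w) := by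
    filter_upwards [isOpen_upperHalfPlaneSet.mem_nhds z.im_pos] with w hw
    have := SlashInvariantFormClass.eq_cuspFunction f ⟨w, hw⟩ one_mem_strictPeriods_SL one_ne_zero
    simpa [ofComplex_apply_of_im_pos hw] using this.symm
  have hF : DifferentiableAt ℂ (cuspFunction 1 f) (𝕢 1 z) :=
    ModularFormClass.differentiableAt_cuspFunction f one_pos one_mem_strictPeriods_SL
      (by simpa using norm_qParam_lt_one 1 z)
  have hq : HasDerivAt (𝕢 1) (2 * π * Complex.I * 𝕢 1 z) (z : ℂ) := by
    have h1 : HasDerivAt (fun w : ℂ ↦ 2 * π * Complex.I * w / (1 : ℝ)) (2 * π * Complex.I) (z : ℂ) := by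
      simpa using (hasDerivAt_id (z : ℂ)).const_mul (2 * π * Complex.I)
    rw [mul_comm]
    exact h1.cexp
  have hcomp : deriv (fun w ↦ cuspFunction 1 f (𝕢 1 w)) (z : ℂ) = _ :=
    (hF.hasDerivAt.comp (z : ℂ) hq).deriv
  rw [normalizedDerivOfComplex, hev.deriv_eq, hcomp]
  have : (2 * π * Complex.I : ℂ) ≠ 0 := Complex.two_pi_I_ne_zero
  field_simp

lemma tendsto_normalizedDeriv_atImInfty {k : ℤ} (f : ModularForm 𝒮ℒ k) :
    Tendsto (normalizedDerivOfComplex f) atImInfty (𝓝 0) := by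
  have hq := qParam_tendsto_atImInfty (h := 1) one_pos
  have hF : ContinuousAt (deriv (cuspFunction 1 f)) 0 :=
    (ModularFormClass.analyticAt_cuspFunction_zero f one_pos
      one_mem_strictPeriods_SL).deriv.continuousAt
  have := hq.mul (hF.tendsto.comp hq)
  rw [zero_mul] at this
  exact this.congr fun z ↦ (normalizedDeriv_eq_qParam_mul_deriv_cuspFunction f z).symm

lemma tendsto_E4_atImInfty : Tendsto (E₄ : ℍ → ℂ) atImInfty (𝓝 1) := by
  have hq := qParam_tendsto_atImInfty (h := 1) one_pos
  have hF := (ModularFormClass.analyticAt_cuspFunction_zero E₄ one_pos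
      one_mem_strictPeriods_SL).continuousAt
  have h0 : cuspFunction 1 E₄ 0 = 1 := by
    have := E_qExpansion_coeff_zero (k := 4) (by norm_num) ⟨2, rfl⟩
    simpa [qExpansion_coeff] using this
  have := hF.tendsto.comp hq
  rw [h0] at this
  exact this.congr fun z ↦
    SlashInvariantFormClass.eq_cuspFunction E₄ z one_mem_strictPeriods_SL one_ne_zero

/-- The first Rankin–Cohen bracket of `E₄` and `E₆`, as a function on `ℍ`. -/
def rankinCohenFun (z : ℍ) : ℂ :=
  4 * (E₄ z * normalizedDerivOfComplex E₆ z) - 6 * (normalizedDerivOfComplex E₄ z * E₆ z)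

/-- The weights 4 and 6 are chosen so that the `E₂` terms of the two Serre derivatives cancel; the
bracket is therefore a combination of genuinely modular products. -/
lemma rankinCohenFun_slash (γ : SL(2, ℤ)) : rankinCohenFun ∣[(12 : ℤ)] γ = rankinCohenFun := by
  have h4 := E4_slash γ
  have h6 := E6_slash γ
  have s4 : serreDerivative (4 : ℤ) E₄ ∣[(6 : ℤ)] γ = serreDerivative (4 : ℤ) E₄ :=
    serreDerivative_slash_invariant E₄.holo' h4
  have s6 : serreDerivative (6 : ℤ) E₆ ∣[(8 : ℤ)] γ = serreDerivative (6 : ℤ) E₆ :=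
    serreDerivative_slash_invariant E₆.holo' h6
  have m1 : ((E₄ : ℍ → ℂ) * serreDerivative (6 : ℤ) E₆) ∣[(12 : ℤ)] γ =
      (E₄ : ℍ → ℂ) * serreDerivative (6 : ℤ) E₆ := by
    have := ModularForm.mul_slash_SL2 4 8 γ (E₄ : ℍ → ℂ) (serreDerivative (6 : ℤ) E₆)
    rwa [h4, s6] at this
  have m2 : (serreDerivative (4 : ℤ) E₄ * (E₆ : ℍ → ℂ)) ∣[(12 : ℤ)] γ =
      serreDerivative (4 : ℤ) E₄ * (E₆ : ℍ → ℂ) := by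
    have := ModularForm.mul_slash_SL2 6 6 γ (serreDerivative (4 : ℤ) E₄) (E₆ : ℍ → ℂ)
    rwa [h6, s4] at this
  have e : rankinCohenFun = (4 : ℂ) • ((E₄ : ℍ → ℂ) * serreDerivative (6 : ℤ) E₆) +
        (-6 : ℂ) • (serreDerivative (4 : ℤ) E₄ * (E₆ : ℍ → ℂ)) := by
    ext z
    simp [rankinCohenFun]
    ring
  rw [e, SlashAction.add_slash, ModularForm.SL_smul_slash, ModularForm.SL_smul_slash, m1, m2]

lemma tendsto_E6_atImInfty : Tendsto (E₆ : ℍ → ℂ) atImInfty (𝓝 1) := by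
  have hq := qParam_tendsto_atImInfty (h := 1) one_pos
  have hF := (ModularFormClass.analyticAt_cuspFunction_zero E₆ one_pos
      one_mem_strictPeriods_SL).continuousAt
  have h0 : cuspFunction 1 E₆ 0 = 1 := by
    have := E_qExpansion_coeff_zero (k := 6) (by norm_num) ⟨3, rfl⟩
    simpa [qExpansion_coeff] using this
  have := hF.tendsto.comp hq
  rw [h0] at this
  exact this.congr fun z ↦
    SlashInvariantFormClass.eq_cuspFunction E₆ z one_mem_strictPeriods_SL one_ne_zero

/-- The first Rankin–Cohen bracket of `E₄` and `E₆`, as a cusp form of weight 12. -/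
def rankinCohenForm : CuspForm 𝒮ℒ 12 where
  toFun := rankinCohenFun
  slash_action_eq' A hA := by
    obtain ⟨γ, rfl⟩ := hA
    exact rankinCohenFun_slash γ
  holo' := by
    have h4 := normalizedDerivOfComplex_mdifferentiable E₄.holo'
    have h6 := normalizedDerivOfComplex_mdifferentiable E₆.holo'
    exact (mdifferentiable_const.mul (E₄.holo'.mul h6)).sub
      (mdifferentiable_const.mul (h4.mul E₆.holo'))
  zero_at_cusps' hc := by
    rw [Subgroup.IsArithmetic.isCusp_iff_isCusp_SL2Z] at hc
    rw [OnePoint.isZeroAt_iff_forall_SL2Z hc]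
    intro γ _
    rw [rankinCohenFun_slash γ]
    have := ((tendsto_E4_atImInfty.mul (tendsto_normalizedDeriv_atImInfty E₆)).const_mul 4).sub
      (((tendsto_normalizedDeriv_atImInfty E₄).mul tendsto_E6_atImInfty).const_mul 6)
    simpa only [mul_zero, zero_mul, sub_zero] using! this

lemma exists_rankinCohenFun_eq : ∃ c : ℂ, ∀ z, rankinCohenFun z = c * ModularForm.discriminant z := by
  obtain ⟨c, hc⟩ := CuspForm.exists_smul_discriminant_of_weight_eq_twelve rankinCohenForm
  exact ⟨c, fun z ↦ (DFunLike.congr_fun hc z).symm⟩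

end Derivatives

/-! ### The modular function `j` and its derivative. -/

section KleinJ

/-- The modular function `j = E₄³ / Δ`. -/
def kleinJ (z : ℍ) : ℂ := E₄ z ^ 3 / ModularForm.discriminant z

lemma kleinJ_smul (γ : SL(2, ℤ)) (z : ℍ) : kleinJ (γ • z) = kleinJ z := by
  have h4 := apply_smul_of_slash_eq (E4_slash γ) z
  have h12 := apply_smul_of_slash_eq (discriminant_slash γ) z
  have hd : denom γ z ≠ 0 := denom_ne_zero γ z
  rw [kleinJ, kleinJ, h4, h12]
  have h0 := discriminant_ne_zero z
  field_simp

lemma kleinJ_sub_1728 (z : ℍ) : kleinJ z - 1728 = E₆ z ^ 2 / ModularForm.discriminant z := by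
  have h0 := discriminant_ne_zero z
  have := discriminant_eq_E₄_cube_sub_E₆_sq z
  rw [kleinJ]
  field_simp
  rw [this]
  ring

lemma E4_eq_zero_iff (z : ℍ) : E₄ z = 0 ↔ kleinJ z = 0 := by
  simp [kleinJ, discriminant_ne_zero]

lemma E6_eq_zero_iff (z : ℍ) : E₆ z = 0 ↔ kleinJ z = 1728 := by
  rw [← sub_eq_zero (a := kleinJ z), kleinJ_sub_1728]
  simp [discriminant_ne_zero]

lemma mdifferentiable_kleinJ : MDiff kleinJ := by
  have h4 := UpperHalfPlane.mdifferentiable_iff.mp E₄.holo'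
  have hd := UpperHalfPlane.mdifferentiable_iff.mp CuspForm.discriminant.holo'
  rw [UpperHalfPlane.mdifferentiable_iff]
  exact (h4.pow 3).div hd fun w hw ↦ discriminant_ne_zero _

lemma analyticAt_comp_ofComplex {f : ℍ → ℂ} (hf : MDiff f) (z : ℍ) :
    AnalyticAt ℂ (f ∘ ofComplex) z :=
  (UpperHalfPlane.mdifferentiable_iff.mp hf).analyticAt (isOpen_upperHalfPlaneSet.mem_nhds z.im_pos)

/-- With `1728 Δ = E₄³ - E₆²`, the numerator of `j'` collapses to `E₄² E₆` times the bracket, and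
the bracket cancels one of the two factors `Δ` below. The constant may still be zero at this stage.
-/
lemma exists_deriv_kleinJ_eq : ∃ c : ℂ, ∀ z : ℍ,
    deriv (kleinJ ∘ ofComplex) z = c * (E₄ z ^ 2 * E₆ z / ModularForm.discriminant z) := by
  obtain ⟨c, hc⟩ := exists_rankinCohenFun_eq
  -- The quotient rule gives `864 E₄² E₆ (4 E₄ E₆' - 6 E₄' E₆) / (1728 Δ)²`, and `1728² / 864 =
  -- 3456`; the factor `2πi` undoes the normalisation of the derivative.
  refine ⟨2 * π * Complex.I * c / 3456, fun z ↦ ?_⟩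
  have h4 := (analyticAt_comp_ofComplex E₄.holo' z).differentiableAt.hasDerivAt
  have h6 := (analyticAt_comp_ofComplex E₆.holo' z).differentiableAt.hasDerivAt
  have e : kleinJ ∘ ofComplex = fun w ↦ (E₄ ∘ ofComplex) w ^ 3 /
      (((E₄ ∘ ofComplex) w ^ 3 - (E₆ ∘ ofComplex) w ^ 2) / 1728) := by
    ext w
    simp [kleinJ, discriminant_eq_E₄_cube_sub_E₆_sq]
  have hz := discriminant_eq_E₄_cube_sub_E₆_sq z
  have h0 := discriminant_ne_zero z
  have h0' : (((E₄ ∘ ofComplex) z ^ 3 - (E₆ ∘ ofComplex) z ^ 2) / 1728) ≠ 0 := by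
    simpa [hz] using h0
  have hder := (h4.fun_pow 3).fun_div (((h4.fun_pow 3).fun_sub (h6.fun_pow 2)).div_const 1728) h0'
  have hrc := hc z
  simp only [rankinCohenFun, normalizedDerivOfComplex] at hrc
  rw [e]
  refine hder.deriv.trans ?_
  have hab : E₄ z ^ 3 = 1728 * ModularForm.discriminant z + E₆ z ^ 2 := by rw [hz]; ring
  have hpi : (2 * π * Complex.I : ℂ) ≠ 0 := Complex.two_pi_I_ne_zero
  simp only [comp_apply, ofComplex_apply, toSlashInvariantForm_coe] at hrc ⊢
  set A := deriv (E₄ ∘ ofComplex) (z : ℂ)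
  set B := deriv (E₆ ∘ ofComplex) (z : ℂ)
  have hrc' : 4 * (E₄ z * B) - 6 * (A * E₆ z) =
      2 * π * Complex.I * c * ModularForm.discriminant z := by
    rw [show 2 * π * Complex.I * c * ModularForm.discriminant z =
      2 * π * Complex.I * (c * ModularForm.discriminant z) by ring, ← hrc]
    field_simp
  have e2 : (E₄ z ^ 3 - E₆ z ^ 2) / 1728 = ModularForm.discriminant z := hz.symm
  rw [e2, div_eq_iff (pow_ne_zero 2 h0)]
  field_simp
  rw [show ModularForm.discriminant z = (E₄ z ^ 3 - E₆ z ^ 2) / 1728 from hz] at hrc' ⊢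
  push_cast
  linear_combination 1728 * E₄ z ^ 2 * E₆ z * hrc'

end KleinJ

open scoped Modular

/-! ### `j` separates the orbits of the full modular group. -/

section KleinJ

lemma tendsto_discriminant_div_qParam :
    Tendsto (fun z : ℍ ↦ ModularForm.discriminant z / 𝕢 1 z) atImInfty (𝓝 1) := by
  refine tendsto_atImInfty_tprod_one_sub_eta_q_pow.congr fun z ↦ ?_
  rw [discriminant_eq_q_prod, mul_div_cancel_left₀ _ (Periodic.qParam_ne_zero _)]

lemma tendsto_kleinJ_mul_qParam :
    Tendsto (fun z : ℍ ↦ kleinJ z * 𝕢 1 z) atImInfty (𝓝 1) := by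
  have := (tendsto_E4_atImInfty.pow 3).div tendsto_discriminant_div_qParam one_ne_zero
  simp only [one_pow, div_one] at this
  refine this.congr fun z ↦ ?_
  have h0 := discriminant_ne_zero z
  have h1 : 𝕢 1 (z : ℂ) ≠ 0 := Periodic.qParam_ne_zero _
  simp only [kleinJ, Pi.div_apply]
  field_simp

lemma tendsto_norm_kleinJ_atImInfty : Tendsto (fun z ↦ ‖kleinJ z‖) atImInfty atTop := by
  have h1 : Tendsto (fun z : ℍ ↦ ‖𝕢 1 z‖⁻¹) atImInfty atTop := by
    refine tendsto_inv_nhdsGT_zero.comp (tendsto_nhdsWithin_iff.mpr ⟨?_, ?_⟩)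
    · simpa using (qParam_tendsto_atImInfty (h := 1) one_pos).norm
    · exact .of_forall fun z ↦ norm_pos_iff.mpr (Periodic.qParam_ne_zero _)
  have h2 := tendsto_kleinJ_mul_qParam.norm
  rw [norm_one] at h2
  refine (h2.pos_mul_atTop one_pos h1).congr fun z ↦ ?_
  rw [norm_mul, mul_inv_cancel_right₀ (norm_ne_zero_iff.mpr (Periodic.qParam_ne_zero _))]

lemma exists_lt_norm_kleinJ (M : ℝ) : ∃ B : ℝ, ∀ z : ℍ, B ≤ z.im → M < ‖kleinJ z‖ := by
  have := tendsto_norm_kleinJ_atImInfty.eventually_gt_atTop M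
  exact (atImInfty_mem _).mp this

lemma continuous_kleinJ : Continuous kleinJ := mdifferentiable_kleinJ.continuous

lemma exists_norm_kleinJ_le (B : ℝ) : ∃ M : ℝ, ∀ z ∈ 𝒟, z.im ≤ B → ‖kleinJ z‖ ≤ M := by
  obtain ⟨M, hM⟩ := (ModularGroup.isCompact_truncatedFundamentalDomain B).exists_bound_of_continuousOn
    continuous_kleinJ.continuousOn
  exact ⟨M, fun z hz hB ↦ hM z ⟨hz, hB⟩⟩

/-- The derivative of `j` is a nonzero multiple of `E₄² E₆ / Δ`. -/
lemma exists_ne_zero_deriv_kleinJ_eq : ∃ c : ℂ, c ≠ 0 ∧ ∀ z : ℍ,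
    deriv (kleinJ ∘ ofComplex) z = c * (E₄ z ^ 2 * E₆ z / ModularForm.discriminant z) := by
  obtain ⟨c, hc⟩ := exists_deriv_kleinJ_eq
  refine ⟨c, ?_, hc⟩
  rintro rfl
  obtain ⟨B, hB⟩ := exists_lt_norm_kleinJ ‖kleinJ UpperHalfPlane.I‖
  have hconst : ∀ z w : ℍ, kleinJ z = kleinJ w := by
    intro z w
    have hconv : IsPreconnected upperHalfPlaneSet := (convex_halfSpace_im_gt 0).isPreconnected
    have hd := UpperHalfPlane.mdifferentiable_iff.mp mdifferentiable_kleinJ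
    have := isOpen_upperHalfPlaneSet.is_const_of_deriv_eq_zero hconv hd
      (fun w hw ↦ by simpa using hc ⟨w, hw⟩) z.im_pos w.im_pos
    simpa using this
  have hpos : 0 < max B 1 := lt_max_of_lt_right one_pos
  have := hB ⟨⟨0, max B 1⟩, hpos⟩ (le_max_left B 1)
  rw [hconst ⟨⟨0, max B 1⟩, hpos⟩ UpperHalfPlane.I] at this
  exact lt_irrefl _ this

lemma deriv_kleinJ_ne_zero {z : ℍ} (h0 : kleinJ z ≠ 0) (h1 : kleinJ z ≠ 1728) :
    deriv (kleinJ ∘ ofComplex) z ≠ 0 := by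
  obtain ⟨c, hc, h⟩ := exists_ne_zero_deriv_kleinJ_eq
  rw [h]
  have h4 := (E4_eq_zero_iff z).not.mpr h0
  have h6 := (E6_eq_zero_iff z).not.mpr h1
  exact mul_ne_zero hc (div_ne_zero (mul_ne_zero (pow_ne_zero _ h4) h6) (discriminant_ne_zero z))

lemma HasStrictDerivAt.exists_injOn {f : ℂ → ℂ} {f' a : ℂ} (hf : HasStrictDerivAt f f' a)
    (hf' : f' ≠ 0) : ∃ U ∈ 𝓝 a, Set.InjOn f U := by
  refine ⟨_, hf.eventually_left_inverse hf', fun x hx y hy hxy ↦ ?_⟩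
  rw [← show _ = x from hx, ← show _ = y from hy, hxy]

lemma exists_injOn_kleinJ {z : ℍ} (h0 : kleinJ z ≠ 0) (h1 : kleinJ z ≠ 1728) :
    ∃ U ∈ 𝓝 z, Set.InjOn kleinJ U := by
  have hs := (analyticAt_comp_ofComplex mdifferentiable_kleinJ z).hasStrictDerivAt
  obtain ⟨U, hU, hinj⟩ := HasStrictDerivAt.exists_injOn hs (deriv_kleinJ_ne_zero h0 h1)
  refine ⟨(↑) ⁻¹' U, continuous_coe.continuousAt.preimage_mem_nhds hU, fun x hx y hy hxy ↦ ?_⟩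
  exact UpperHalfPlane.ext (hinj hx hy (by simpa using hxy))

lemma exists_T_zpow_smul_of_qParam_eq {z w : ℍ} (h : 𝕢 1 (z : ℂ) = 𝕢 1 w) :
    ∃ n : ℤ, w = ModularGroup.T ^ n • z := by
  rw [Periodic.qParam, Periodic.qParam, Complex.exp_eq_exp_iff_exists_int] at h
  obtain ⟨n, hn⟩ := h
  refine ⟨-n, UpperHalfPlane.ext ?_⟩
  rw [ModularGroup.coe_T_zpow_smul_eq]
  have hpi : (2 * π * Complex.I : ℂ) ≠ 0 := Complex.two_pi_I_ne_zero
  push_cast at hn ⊢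
  refine mul_left_cancel₀ hpi ?_
  linear_combination -hn

/-- High up in the upper half-plane, `j` is injective modulo translations. -/
lemma exists_kleinJ_injective_atImInfty : ∃ B : ℝ, ∀ z w : ℍ, B ≤ z.im → B ≤ w.im →
    kleinJ z = kleinJ w → ∃ γ : SL(2, ℤ), w = γ • z := by
  have hE := ModularFormClass.analyticAt_cuspFunction_zero E₄ one_pos one_mem_strictPeriods_SL
  have hΔ := ModularFormClass.analyticAt_cuspFunction_zero CuspForm.discriminant one_pos
    one_mem_strictPeriods_SL
  have hE0 : cuspFunction 1 E₄ 0 = 1 := by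
    have := E_qExpansion_coeff_zero (k := 4) (by norm_num) ⟨2, rfl⟩
    simpa [qExpansion_coeff] using this
  have hΔ0 : cuspFunction 1 CuspForm.discriminant 0 = 0 :=
    CuspFormClass.cuspFunction_apply_zero _ one_pos one_mem_strictPeriods_SL
  have hΔ1 : deriv (cuspFunction 1 CuspForm.discriminant) 0 = 1 := by
    simpa [qExpansion_coeff] using discriminant_qExpansion_coeff_one
  -- As a function of `q`, the inverse `1/j = Δ/E₄³` is analytic at 0 with derivative 1, hence
  -- injective near `q = 0`.
  have hs := hΔ.hasStrictDerivAt.fun_div (hE.hasStrictDerivAt.fun_pow 3) (by simp [hE0])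
  rw [hE0, hΔ0, hΔ1] at hs
  obtain ⟨U, hU, hinj⟩ := HasStrictDerivAt.exists_injOn hs (by simp)
  have hev := (qParam_tendsto_atImInfty (h := 1) one_pos).eventually hU
  obtain ⟨B, hB⟩ := (atImInfty_mem _).mp hev
  refine ⟨B, fun z w hz hw h ↦ ?_⟩
  have key (u : ℍ) : cuspFunction 1 CuspForm.discriminant (𝕢 1 u) / cuspFunction 1 E₄ (𝕢 1 u) ^ 3
      = (kleinJ u)⁻¹ := by
    rw [SlashInvariantFormClass.eq_cuspFunction E₄ u one_mem_strictPeriods_SL one_ne_zero,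
      SlashInvariantFormClass.eq_cuspFunction CuspForm.discriminant u one_mem_strictPeriods_SL
        one_ne_zero, kleinJ, inv_div]
    rfl
  obtain ⟨n, hn⟩ := exists_T_zpow_smul_of_qParam_eq
    (hinj (hB z hz) (hB w hw) (by simp only [key, h]))
  exact ⟨_, hn⟩

/-- The set of values of `j` attained on at least two distinct orbits. -/
def kleinJMultipleValues : Set ℂ :=
  {x | ∃ z w : ℍ, kleinJ z = x ∧ kleinJ w = x ∧ ∀ γ : SL(2, ℤ), w ≠ γ • z}

/-- Open mapping theorem. If `j` were locally constant, `E₄ E₆` would vanish near a point, hence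
everywhere, against its limit 1 at `i∞`. -/
lemma kleinJ_image_mem_nhds {z : ℍ} {V : Set ℍ} (hV : V ∈ 𝓝 z) : kleinJ '' V ∈ 𝓝 (kleinJ z) := by
  have ha := analyticAt_comp_ofComplex mdifferentiable_kleinJ z
  rcases ha.eventually_constant_or_nhds_le_map_nhds with h | h
  · exfalso
    have hd : ∀ᶠ w in 𝓝 (z : ℂ), deriv (kleinJ ∘ ofComplex) w = 0 := by
      filter_upwards [h.eventually_nhds] with w hw
      have : kleinJ ∘ ofComplex =ᶠ[𝓝 w] fun _ ↦ (kleinJ ∘ ofComplex) z := hw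
      rw [this.deriv_eq]
      simp
    obtain ⟨c, hc, hder⟩ := exists_ne_zero_deriv_kleinJ_eq
    have hbad : ∀ᶠ w in 𝓝 z, (E₄ * E₆ : ℍ → ℂ) w = 0 := by
      filter_upwards [continuous_coe.continuousAt.eventually hd] with w hw
      rw [hder] at hw
      simpa [hc, discriminant_ne_zero] using hw
    have : (E₄ * E₆ : ℍ → ℂ) = 0 := eq_zero_of_frequently (E₄.holo'.mul E₆.holo')
      (τ := z) (hbad.filter_mono nhdsWithin_le_nhds).frequently
    have h1 := tendsto_E4_atImInfty.mul tendsto_E6_atImInfty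
    have h2 : Tendsto (0 : ℍ → ℂ) atImInfty (𝓝 (1 * 1)) := by rw [← this]; exact h1
    have : (1 * 1 : ℂ) = 0 := tendsto_nhds_unique h2 tendsto_const_nhds
    simp at this
  · have hmem : (↑) '' V ∈ 𝓝 (z : ℂ) := isOpenEmbedding_coe.image_mem_nhds.mpr hV
    have := h (image_mem_map hmem)
    simpa [Set.image_image] using this

instance : ContinuousConstSMul SL(2, ℤ) ℍ :=
  ⟨fun γ ↦ continuous_const_smul (γ : GL (Fin 2) ℝ)⟩

lemma mk_SL2Z_smul (γ : SL(2, ℤ)) (z : ℍ) :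
    (Quotient.mk _ (γ • z) : MulAction.orbitRel.Quotient 𝒮ℒ ℍ) = Quotient.mk _ z :=
  Quotient.sound (MulAction.orbitRel_apply.mpr
    ⟨(⟨Matrix.SpecialLinearGroup.mapGL ℝ γ, γ, rfl⟩ : 𝒮ℒ), rfl⟩)

lemma exists_smul_eq_of_mk_SL2Z_eq {z w : ℍ}
    (h : (Quotient.mk _ w : MulAction.orbitRel.Quotient 𝒮ℒ ℍ) = Quotient.mk _ z) :
    ∃ γ : SL(2, ℤ), w = γ • z := by
  obtain ⟨⟨_, γ, rfl⟩, hγ⟩ := MulAction.orbitRel_apply.mp (Quotient.exact h)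
  exact ⟨γ, hγ.symm⟩

/-- Inequivalent points have neighbourhoods no two points of which are equivalent. -/
lemma exists_nhds_inequivalent {z w : ℍ} (hne : ∀ γ : SL(2, ℤ), w ≠ γ • z) :
    ∃ U ∈ 𝓝 z, ∃ V ∈ 𝓝 w, ∀ a ∈ U, ∀ γ : SL(2, ℤ), γ • a ∉ V := by
  -- The action is properly discontinuous, so the orbit space is Hausdorff and separation can be
  -- done there.
  have : T2Space (MulAction.orbitRel.Quotient 𝒮ℒ ℍ) :=
    t2Space_of_properlyDiscontinuousSMul_of_t2Space
  have hne' : (Quotient.mk _ z : MulAction.orbitRel.Quotient 𝒮ℒ ℍ) ≠ Quotient.mk _ w := by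
    intro h
    obtain ⟨γ, hγ⟩ := exists_smul_eq_of_mk_SL2Z_eq h.symm
    exact hne γ hγ
  obtain ⟨U, V, hU, hV, hzU, hwV, hUV⟩ := t2_separation hne'
  refine ⟨_, (hU.preimage continuous_quotient_mk').mem_nhds hzU, _,
    (hV.preimage continuous_quotient_mk').mem_nhds hwV, fun a ha γ hγ ↦ ?_⟩
  have hb' : (Quotient.mk _ (γ • a) : MulAction.orbitRel.Quotient 𝒮ℒ ℍ) ∈ V := hγ
  rw [mk_SL2Z_smul] at hb'
  exact Set.disjoint_left.mp hUV ha hb'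

lemma isOpen_kleinJMultipleValues : IsOpen kleinJMultipleValues := by
  rw [isOpen_iff_mem_nhds]
  rintro x ⟨z, w, hz, hw, hne⟩
  obtain ⟨U, hU, V, hV, h⟩ := exists_nhds_inequivalent hne
  have hUz := kleinJ_image_mem_nhds hU
  have hVw := kleinJ_image_mem_nhds hV
  rw [hz] at hUz
  rw [hw] at hVw
  filter_upwards [hUz, hVw]
  rintro _ ⟨a, ha, rfl⟩ ⟨b, hb, hab⟩
  exact ⟨a, b, rfl, hab, fun γ hγ ↦ h a ha γ (hγ ▸ hb)⟩

lemma mem_kleinJMultipleValues_iff {x : ℂ} : x ∈ kleinJMultipleValues ↔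
    ∃ z ∈ 𝒟, ∃ w ∈ 𝒟, kleinJ z = x ∧ kleinJ w = x ∧ ∀ γ : SL(2, ℤ), w ≠ γ • z := by
  constructor
  · rintro ⟨z, w, hz, hw, hne⟩
    obtain ⟨α, hα⟩ := ModularGroup.exists_smul_mem_fd z
    obtain ⟨β, hβ⟩ := ModularGroup.exists_smul_mem_fd w
    refine ⟨_, hα, _, hβ, by rw [kleinJ_smul, hz], by rw [kleinJ_smul, hw], fun γ h ↦ ?_⟩
    refine hne (β⁻¹ * γ * α) ?_
    rw [mul_smul, mul_smul, ← h, inv_smul_smul]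
  · rintro ⟨z, -, w, -, h⟩
    exact ⟨z, w, h⟩

/-- Bounded values of `j` on `𝒟` come from a compact truncation, so pairs of inequivalent preimages
subconverge. The limits stay inequivalent because `j` is locally injective away from the values 0
and 1728. -/
lemma closure_kleinJMultipleValues_inter_subset :
    closure kleinJMultipleValues ∩ {0, 1728}ᶜ ⊆ kleinJMultipleValues := by
  rintro x ⟨hx, hx'⟩
  simp only [Set.mem_compl_iff, Set.mem_insert_iff, Set.mem_singleton_iff, not_or] at hx'
  obtain ⟨u, hu, hlim⟩ := mem_closure_iff_seq_limit.mp hx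
  choose z hz w hw hzu hwu hne using fun n ↦ mem_kleinJMultipleValues_iff.mp (hu n)
  obtain ⟨B, hB⟩ := exists_lt_norm_kleinJ (‖x‖ + 1)
  have hev : ∀ᶠ n in atTop, ‖u n‖ < ‖x‖ + 1 := hlim.norm.eventually_lt_const (lt_add_one _)
  have hmem : ∀ᶠ n in atTop, (z n, w n) ∈ ModularGroup.truncatedFundamentalDomain B ×ˢ
      ModularGroup.truncatedFundamentalDomain B := by
    filter_upwards [hev] with n hn
    refine ⟨⟨hz n, ?_⟩, ⟨hw n, ?_⟩⟩
    · by_contra! h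
      have := hB _ h.le
      rw [hzu] at this
      linarith
    · by_contra! h
      have := hB _ h.le
      rw [hwu] at this
      linarith
  have hK := ModularGroup.isCompact_truncatedFundamentalDomain B
  obtain ⟨⟨a, b⟩, -, φ, hφ, hab⟩ := (hK.prod hK).tendsto_subseq' hmem.frequently
  rw [Prod.tendsto_iff] at hab
  have ha : Tendsto (z ∘ φ) atTop (𝓝 a) := hab.1
  have hb : Tendsto (w ∘ φ) atTop (𝓝 b) := hab.2
  have hlim' : Tendsto (u ∘ φ) atTop (𝓝 x) := hlim.comp hφ.tendsto_atTop
  have hja : kleinJ a = x := tendsto_nhds_unique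
    (((continuous_kleinJ.tendsto a).comp ha).congr fun n ↦ hzu (φ n)) hlim'
  have hjb : kleinJ b = x := tendsto_nhds_unique
    (((continuous_kleinJ.tendsto b).comp hb).congr fun n ↦ hwu (φ n)) hlim'
  refine ⟨a, b, hja, hjb, ?_⟩
  rintro γ rfl
  obtain ⟨U, hU, hinj⟩ := exists_injOn_kleinJ (z := a) (by rw [hja]; exact hx'.1)
    (by rw [hja]; exact hx'.2)
  -- If the limits were equivalent, `z n` and `γ⁻¹ • w n` would eventually share a neighbourhood on
  -- which `j` is injective, and so coincide.
  have hb' : Tendsto (fun n ↦ γ⁻¹ • w (φ n)) atTop (𝓝 a) := by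
    have := ((continuous_const_smul γ⁻¹).tendsto _).comp hb
    rwa [inv_smul_smul] at this
  obtain ⟨n, hn1, hn2⟩ := ((ha.eventually hU).and (hb'.eventually hU)).exists
  have := hinj hn1 hn2 (by rw [kleinJ_smul, hwu, comp_apply, hzu])
  exact hne (φ n) γ (by rw [show z (φ n) = _ from this, smul_inv_smul])

/-- The set is open and relatively closed in the connected set `{0, 1728}ᶜ`, which is dense. If
nonempty it would contain every value other than 0 and 1728, yet very large values are attained on a
single orbit. -/
lemma kleinJMultipleValues_eq_empty : kleinJMultipleValues = ∅ := by
  by_contra! hne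
  have hconn : IsPreconnected ({0, 1728}ᶜ : Set ℂ) :=
    ((Set.toFinite {0, 1728}).countable.isConnected_compl_of_one_lt_rank
      (by simp)).isPreconnected
  have hdense : Dense ({0, 1728}ᶜ : Set ℂ) :=
    (Set.toFinite ({0, 1728} : Set ℂ)).countable.dense_compl ℝ
  have hsub := hconn.subset_of_closure_inter_subset isOpen_kleinJMultipleValues
    (by rw [Set.inter_comm]; exact hdense.inter_open_nonempty _ isOpen_kleinJMultipleValues hne)
    closure_kleinJMultipleValues_inter_subset
  obtain ⟨B, hB⟩ := exists_kleinJ_injective_atImInfty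
  obtain ⟨M, hM⟩ := exists_norm_kleinJ_le B
  obtain ⟨C, hC⟩ := exists_lt_norm_kleinJ (max M 1728)
  have hlarge := hC ⟨⟨0, max C 1⟩, lt_max_of_lt_right one_pos⟩ (le_max_left C 1)
  -- The value `j(t)` exceeds both 1728 and the bound `M` for `j` on the part of `𝒟` below height
  -- `B`, so all its preimages in `𝒟` lie where `j` is injective modulo equivalence.
  set t : ℍ := ⟨⟨0, max C 1⟩, lt_max_of_lt_right one_pos⟩
  have hmem : kleinJ t ∈ kleinJMultipleValues := by
    refine hsub ?_
    simp only [Set.mem_compl_iff, Set.mem_insert_iff, Set.mem_singleton_iff, not_or]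
    constructor
    · intro h
      rw [h, norm_zero] at hlarge
      linarith [le_max_right M 1728]
    · intro h
      rw [h] at hlarge
      norm_num at hlarge
  obtain ⟨z, hz, w, hw, hzt, hwt, hne⟩ := mem_kleinJMultipleValues_iff.mp hmem
  have key : ∀ y ∈ 𝒟, kleinJ y = kleinJ t → B ≤ y.im := by
    intro y hy hyt
    by_contra! h
    have := hM y hy h.le
    rw [hyt] at this
    linarith [le_max_left M 1728]
  obtain ⟨γ, hγ⟩ := hB z w (key z hz hzt) (key w hw hwt) (hzt.trans hwt.symm)
  exact hne γ hγ

/-- `j` separates the orbits of `SL(2, ℤ)`. -/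
theorem exists_smul_eq_of_kleinJ_eq {z w : ℍ} (h : kleinJ z = kleinJ w) :
    ∃ γ : SL(2, ℤ), w = γ • z := by
  by_contra! hne
  have : kleinJ z ∈ kleinJMultipleValues := ⟨z, w, rfl, h.symm, hne⟩
  rw [kleinJMultipleValues_eq_empty] at this
  exact this

end KleinJ

/-! ### Ramification of `j` and stabilizers. -/

section KleinJOrder

lemma mdifferentiable_E4 : MDiff (E₄ : ℍ → ℂ) := E₄.holo'

lemma mdifferentiable_E6 : MDiff (E₆ : ℍ → ℂ) := E₆.holo'

lemma mdifferentiable_discriminant : MDiff ModularForm.discriminant := CuspForm.discriminant.holo'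

lemma eq_natCast_mul_of_coe {n m : ℤ} {k : ℕ}
    (h : (n : WithTop ℤ) = (k : WithTop ℤ) * (m : WithTop ℤ)) : n = k * m := by
  rw [show ((k : ℕ) : WithTop ℤ) = ((k : ℤ) : WithTop ℤ) from rfl, ← WithTop.coe_mul] at h
  exact WithTop.coe_injective h

/-- The order of vanishing of a function on `ℍ`, with value `⊤` for locally zero functions. -/
abbrev orderAt (f : ℍ → ℂ) (z : ℍ) : WithTop ℤ := meromorphicOrderAt (f ∘ ofComplex) (z : ℂ)

lemma orderAt_eq_zero {f : ℍ → ℂ} (hf : MDiff f) {z : ℍ} (hz : f z ≠ 0) : orderAt f z = 0 := by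
  rw [orderAt, (analyticAt_comp_ofComplex hf z).meromorphicNFAt.meromorphicOrderAt_eq_zero_iff]
  simpa using hz

lemma orderAt_kleinJ_sub_of_ne {c : ℂ} {z : ℍ} (h : kleinJ z ≠ c) :
    orderAt (fun w ↦ kleinJ w - c) z = 0 :=
  orderAt_eq_zero (mdifferentiable_kleinJ.sub mdifferentiable_const) (sub_ne_zero.mpr h)

lemma orderAt_kleinJ_sub_ne_top (c : ℂ) (z : ℍ) : orderAt (fun w ↦ kleinJ w - c) z ≠ ⊤ := by
  intro h
  by_cases hz : kleinJ z = c
  · rw [meromorphicOrderAt_eq_top_iff, eventually_nhdsWithin_iff] at h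
    have hV : {w | kleinJ w = c} ∈ 𝓝 z := by
      filter_upwards [continuous_coe.continuousAt.eventually h] with w hw
      rcases eq_or_ne w z with rfl | hwz
      · exact hz
      · simpa [sub_eq_zero] using hw fun h ↦ hwz (UpperHalfPlane.ext h)
    have h1 := kleinJ_image_mem_nhds hV
    have h2 : {kleinJ z} ∈ 𝓝 (kleinJ z) := by
      filter_upwards [h1]
      rintro _ ⟨w, hw, rfl⟩
      rw [hz]
      exact hw
    have := (mem_nhds_iff.mp h2)
    obtain ⟨U, hU, hUo, hzU⟩ := this
    have : IsOpen ({kleinJ z} : Set ℂ) := by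
      rwa [← Set.Subset.antisymm hU (Set.singleton_subset_iff.mpr hzU)]
    exact not_isOpen_singleton _ this
  · rw [orderAt_kleinJ_sub_of_ne hz] at h
    exact WithTop.zero_ne_top h

/-- Differentiation lowers a nonzero order by one, so `j' = c E₄² E₆ / Δ` becomes an equation
between orders, `Δ` contributing nothing. -/
lemma orderAt_deriv_kleinJ {c : ℂ} {z : ℍ} {n : ℤ} (hz : kleinJ z = c)
    (hn : orderAt (fun w ↦ kleinJ w - c) z = n) :
    ((n - 1 : ℤ) : WithTop ℤ) = ((2 : ℕ) : WithTop ℤ) * orderAt E₄ z + orderAt E₆ z := by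
  have han := analyticAt_comp_ofComplex
    (mdifferentiable_kleinJ.sub (mdifferentiable_const (c := c))) z
  have hpos : n ≠ 0 := by
    rintro rfl
    rw [orderAt] at hn
    exact (han.meromorphicNFAt.meromorphicOrderAt_eq_zero_iff.mp hn) (by simp [hz])
  rw [← meromorphicOrderAt_deriv_eq_sub_one (by exact_mod_cast hpos) hn]
  obtain ⟨c', hc', hder⟩ := exists_ne_zero_deriv_kleinJ_eq
  have hΔ : AnalyticAt ℂ (fun w : ℂ ↦ c' / ModularForm.discriminant (ofComplex w)) z :=
    analyticAt_const.div (analyticAt_comp_ofComplex mdifferentiable_discriminant z)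
      (discriminant_ne_zero _)
  have h4 := analyticAt_comp_ofComplex mdifferentiable_E4 z
  have h6 := analyticAt_comp_ofComplex mdifferentiable_E6 z
  have hev : deriv ((fun w ↦ kleinJ w - c) ∘ ofComplex) =ᶠ[𝓝[≠] (z : ℂ)]
      (fun w : ℂ ↦ c' / ModularForm.discriminant (ofComplex w)) *
        ((E₄ ∘ ofComplex) ^ 2 * (E₆ ∘ ofComplex)) := by
    refine EventuallyEq.filter_mono ?_ nhdsWithin_le_nhds
    filter_upwards [isOpen_upperHalfPlaneSet.mem_nhds z.im_pos] with w hw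
    have := hder ⟨w, hw⟩
    have e : (fun w ↦ kleinJ w - c) ∘ ofComplex = fun w ↦ (kleinJ ∘ ofComplex) w - c := rfl
    rw [e, deriv_sub_const, this]
    simp only [Pi.mul_apply, Pi.pow_apply, comp_apply, ofComplex_apply_of_im_pos hw]
    ring
  rw [meromorphicOrderAt_congr hev, meromorphicOrderAt_mul_of_ne_zero hΔ
    (div_ne_zero hc' (discriminant_ne_zero _)),
    meromorphicOrderAt_mul (h4.meromorphicAt.pow 2) h6.meromorphicAt,
    meromorphicOrderAt_pow h4.meromorphicAt]

lemma orderAt_kleinJ_of_ne {z : ℍ} (h0 : kleinJ z ≠ 0) (h1 : kleinJ z ≠ 1728) :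
    orderAt (fun w ↦ kleinJ w - kleinJ z) z = 1 := by
  obtain ⟨n, hn⟩ := WithTop.ne_top_iff_exists.mp (orderAt_kleinJ_sub_ne_top (kleinJ z) z)
  have h := orderAt_deriv_kleinJ rfl hn.symm
  rw [orderAt_eq_zero mdifferentiable_E4 ((E4_eq_zero_iff z).not.mpr h0),
    orderAt_eq_zero mdifferentiable_E6 ((E6_eq_zero_iff z).not.mpr h1), mul_zero, add_zero] at h
  rw [← hn]
  have : n - 1 = 0 := by exact_mod_cast h
  rw [show n = 1 by lia]
  rfl

/-- If `m` is the order of `E₄`, then `n = 3m` from `j = E₄³/Δ` and `n - 1 = 2m` from the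
derivative; hence `m = 1`. -/
lemma orderAt_kleinJ_of_eq_zero {z : ℍ} (h0 : kleinJ z = 0) :
    orderAt (fun w ↦ kleinJ w - 0) z = 3 := by
  obtain ⟨n, hn⟩ := WithTop.ne_top_iff_exists.mp (orderAt_kleinJ_sub_ne_top 0 z)
  have h := orderAt_deriv_kleinJ h0 hn.symm
  have h1 : E₆ z ≠ 0 := (E6_eq_zero_iff z).not.mpr (by rw [h0]; norm_num)
  rw [orderAt_eq_zero mdifferentiable_E6 h1, add_zero] at h
  have h4 := analyticAt_comp_ofComplex mdifferentiable_E4 z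
  have hd := analyticAt_comp_ofComplex mdifferentiable_discriminant z
  have hn' : orderAt (fun w ↦ kleinJ w - 0) z = ((3 : ℕ) : WithTop ℤ) * orderAt E₄ z := by
    have e : ((fun w ↦ kleinJ w - 0) ∘ ofComplex) =
        (ModularForm.discriminant ∘ ofComplex)⁻¹ * (E₄ ∘ ofComplex) ^ 3 := by
      ext w
      simp [kleinJ, div_eq_mul_inv, mul_comm]
    rw [orderAt, e, meromorphicOrderAt_mul_of_ne_zero (hd.inv (discriminant_ne_zero _))
      (inv_ne_zero (discriminant_ne_zero _)), meromorphicOrderAt_pow h4.meromorphicAt]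
  rw [← hn] at hn' ⊢
  have hne : orderAt E₄ z ≠ ⊤ := by
    intro ht
    rw [ht, WithTop.mul_top (by norm_num)] at h
    exact WithTop.coe_ne_top h
  obtain ⟨m, hm⟩ := WithTop.ne_top_iff_exists.mp hne
  rw [← hm] at h hn'
  have a := eq_natCast_mul_of_coe h
  have b := eq_natCast_mul_of_coe hn'
  rw [show n = 3 by lia]
  rfl

/-- Here `j - 1728 = E₆²/Δ` gives `n = 2m` and the derivative gives `n - 1 = m`, where `m` is the
order of `E₆`. -/
lemma orderAt_kleinJ_of_eq_1728 {z : ℍ} (h0 : kleinJ z = 1728) :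
    orderAt (fun w ↦ kleinJ w - 1728) z = 2 := by
  obtain ⟨n, hn⟩ := WithTop.ne_top_iff_exists.mp (orderAt_kleinJ_sub_ne_top 1728 z)
  have h := orderAt_deriv_kleinJ h0 hn.symm
  have h1 : E₄ z ≠ 0 := (E4_eq_zero_iff z).not.mpr (by rw [h0]; norm_num)
  rw [orderAt_eq_zero mdifferentiable_E4 h1, mul_zero, zero_add] at h
  have h6 := analyticAt_comp_ofComplex mdifferentiable_E6 z
  have hd := analyticAt_comp_ofComplex mdifferentiable_discriminant z
  have hn' : orderAt (fun w ↦ kleinJ w - 1728) z = ((2 : ℕ) : WithTop ℤ) * orderAt E₆ z := by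
    have e : ((fun w ↦ kleinJ w - 1728) ∘ ofComplex) =
        (ModularForm.discriminant ∘ ofComplex)⁻¹ * (E₆ ∘ ofComplex) ^ 2 := by
      ext w
      simp [kleinJ_sub_1728, div_eq_mul_inv, mul_comm]
    rw [orderAt, e, meromorphicOrderAt_mul_of_ne_zero (hd.inv (discriminant_ne_zero _))
      (inv_ne_zero (discriminant_ne_zero _)), meromorphicOrderAt_pow h6.meromorphicAt]
  rw [← hn] at hn' ⊢
  rw [← h] at hn'
  have b := eq_natCast_mul_of_coe hn'
  rw [show n = 2 by lia]
  rfl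

/-- `S` fixes `i` with automorphy factor `i ^ 6 = -1`. -/
lemma E6_I : E₆ UpperHalfPlane.I = 0 := by
  have h := apply_smul_of_slash_eq (E6_slash ModularGroup.S) UpperHalfPlane.I
  rw [ModularGroup.stabilizer_I.mpr (by simp), ModularGroup.denom_S, coe_I] at h
  have : (Complex.I ^ (6 : ℤ)) = -1 := by
    rw [show (6 : ℤ) = (6 : ℕ) from rfl, zpow_natCast, show 6 = 2 * 3 from rfl, pow_mul,
      Complex.I_sq]
    norm_num
  rw [this] at h
  linear_combination h / 2

/-- `ST` fixes `ρ` with automorphy factor `(ρ + 1) ^ 4 = -ρ - 1`, which is not 1. -/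
lemma E4_ρ : E₄ ρ = 0 := by
  have h := apply_smul_of_slash_eq (E4_slash (ModularGroup.S * ModularGroup.T)) ρ
  rw [ModularGroup.stabilizer_ρ.mpr (by simp)] at h
  have hd : denom ((ModularGroup.S * ModularGroup.T : SL(2, ℤ)) : GL (Fin 2) ℝ) ρ = ρ + 1 := by
    rw [ModularGroup.denom_apply]
    have h0 : (ModularGroup.S * ModularGroup.T) 1 0 = 1 := by decide
    have h1 : (ModularGroup.S * ModularGroup.T) 1 1 = 1 := by decide
    rw [h0, h1]
    simp
  rw [hd] at h
  have h4 : ((ρ : ℂ) + 1) ^ (4 : ℤ) = -ρ - 1 := by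
    rw [show (4 : ℤ) = (4 : ℕ) from rfl, zpow_natCast]
    have := ρ_sq
    linear_combination ((ρ : ℂ) ^ 2 + 3 * ρ + 2) * this
  rw [h4] at h
  have hρ : (ρ : ℂ) + 2 ≠ 0 := by
    intro h'
    have := congrArg Complex.im h'
    simp [ρ] at this
  have : E₄ ρ * ((ρ : ℂ) + 2) = 0 := by linear_combination h
  exact (mul_eq_zero.mp this).resolve_right hρ

lemma kleinJ_I : kleinJ UpperHalfPlane.I = 1728 := (E6_eq_zero_iff _).mp E6_I

lemma kleinJ_ρ : kleinJ ρ = 0 := (E4_eq_zero_iff _).mp E4_ρ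

lemma card_stabilizer_smul (γ : SL(2, ℤ)) (z : ℍ) :
    Nat.card (MulAction.stabilizer SL(2, ℤ) (γ • z)) = Nat.card (MulAction.stabilizer SL(2, ℤ) z) :=
  (Nat.card_congr (MulAction.stabilizerEquivStabilizer (g := γ) (a := z) rfl).toEquiv).symm

lemma card_stabilizer_of_mem_iff {z : ℍ} {s : Finset SL(2, ℤ)} (h : ∀ g, g • z = z ↔ g ∈ s) :
    Nat.card (MulAction.stabilizer SL(2, ℤ) z) = s.card := by
  have e : (MulAction.stabilizer SL(2, ℤ) z : Set SL(2, ℤ)) = s := by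
    ext g
    simpa [-ModularGroup.sl_moeb] using h g
  calc Nat.card (MulAction.stabilizer SL(2, ℤ) z)
      = Nat.card ((MulAction.stabilizer SL(2, ℤ) z : Set SL(2, ℤ))) := rfl
    _ = s.card := by rw [e]; simp

lemma card_stabilizer_I : Nat.card (MulAction.stabilizer SL(2, ℤ) UpperHalfPlane.I) = 4 :=
  (card_stabilizer_of_mem_iff fun _ ↦ ModularGroup.stabilizer_I).trans (by decide)

lemma card_stabilizer_ρ : Nat.card (MulAction.stabilizer SL(2, ℤ) ρ) = 6 :=
  (card_stabilizer_of_mem_iff fun _ ↦ ModularGroup.stabilizer_ρ).trans (by decide)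

lemma card_stabilizer_of_kleinJ_ne {z : ℍ} (h0 : kleinJ z ≠ 0) (h1 : kleinJ z ≠ 1728) :
    Nat.card (MulAction.stabilizer SL(2, ℤ) z) = 2 := by
  obtain ⟨γ, hγ⟩ := ModularGroup.exists_smul_mem_fd z
  rw [← card_stabilizer_smul γ]
  rw [← kleinJ_smul γ] at h0 h1
  refine (card_stabilizer_of_mem_iff (s := {1, -1}) fun g ↦ ⟨fun hg ↦ ?_, fun hg ↦ ?_⟩).trans
    (by decide)
  · have := ModularGroup.stabilizer_of_ne hγ hg
      (by intro h; rw [h] at h1; exact h1 kleinJ_I)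
      (by intro h; rw [h] at h0; exact h0 kleinJ_ρ)
      (by intro h; rw [h, ← modular_T_smul, kleinJ_smul] at h0; exact h0 kleinJ_ρ)
    simpa using this
  · simp only [Finset.mem_insert, Finset.mem_singleton] at hg
    rcases hg with rfl | rfl
    · rw [one_smul]
    · rw [ModularGroup.SL_neg_smul, one_smul]

lemma card_stabilizer_of_kleinJ_eq {z w : ℍ} (h : kleinJ z = kleinJ w) :
    Nat.card (MulAction.stabilizer SL(2, ℤ) z) = Nat.card (MulAction.stabilizer SL(2, ℤ) w) := by
  obtain ⟨γ, rfl⟩ := exists_smul_eq_of_kleinJ_eq h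
  rw [card_stabilizer_smul]

/-- The ramification index of `j` at `z` is the order of the stabilizer of `z` in
`PSL(2, ℤ)`. It is encoded by the integer `e` such that the stabilizer in `SL(2, ℤ)` has
order `2 e`. -/
theorem exists_orderAt_kleinJ (z : ℍ) : ∃ e : ℕ, e ∣ 12 ∧ 0 < e ∧
    Nat.card (MulAction.stabilizer SL(2, ℤ) z) = 2 * e ∧
    ∀ w, kleinJ w = kleinJ z → orderAt (fun w ↦ kleinJ w - kleinJ z) w = (e : ℤ) := by
  by_cases h0 : kleinJ z = 0
  · refine ⟨3, by norm_num, by norm_num, ?_, fun w hw ↦ ?_⟩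
    · rw [card_stabilizer_of_kleinJ_eq (h0.trans kleinJ_ρ.symm), card_stabilizer_ρ]
    · rw [h0] at hw ⊢
      exact orderAt_kleinJ_of_eq_zero hw
  by_cases h1 : kleinJ z = 1728
  · refine ⟨2, by norm_num, by norm_num, ?_, fun w hw ↦ ?_⟩
    · rw [card_stabilizer_of_kleinJ_eq (h1.trans kleinJ_I.symm), card_stabilizer_I]
    · rw [h1] at hw ⊢
      exact orderAt_kleinJ_of_eq_1728 hw
  · refine ⟨1, by norm_num, by norm_num, card_stabilizer_of_kleinJ_ne h0 h1, fun w hw ↦ ?_⟩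
    rw [← hw] at h0 h1 ⊢
    exact orderAt_kleinJ_of_ne h0 h1

end KleinJOrder

/-! ### Exponents of growth at `i∞`. -/

section CuspOrder

/-- `f` is asymptotic to a nonzero multiple of `exp(2πiντ)` as `Im τ → ∞`. -/
def HasCuspOrder (f : ℍ → ℂ) (ν : ℝ) : Prop :=
  ∃ c : ℂ, c ≠ 0 ∧
    Tendsto (fun τ : ℍ ↦ f τ * Complex.exp (-(2 * π * Complex.I * ν * τ))) atImInfty (𝓝 c)

namespace HasCuspOrder

variable {f g : ℍ → ℂ} {ν μ : ℝ}

lemma mul (hf : HasCuspOrder f ν) (hg : HasCuspOrder g μ) :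
    HasCuspOrder (fun τ ↦ f τ * g τ) (ν + μ) := by
  obtain ⟨c, hc, hfc⟩ := hf
  obtain ⟨d, hd, hgd⟩ := hg
  refine ⟨c * d, mul_ne_zero hc hd, (hfc.mul hgd).congr fun τ ↦ ?_⟩
  rw [mul_mul_mul_comm, ← Complex.exp_add]
  push_cast
  ring_nf

lemma inv (hf : HasCuspOrder f ν) : HasCuspOrder (fun τ ↦ (f τ)⁻¹) (-ν) := by
  obtain ⟨c, hc, hfc⟩ := hf
  refine ⟨c⁻¹, inv_ne_zero hc, (hfc.inv₀ hc).congr fun τ ↦ ?_⟩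
  rw [mul_inv, ← Complex.exp_neg]
  push_cast
  ring_nf

lemma const {c : ℂ} (hc : c ≠ 0) : HasCuspOrder (fun _ ↦ c) 0 :=
  ⟨c, hc, by simp⟩

lemma pow (hf : HasCuspOrder f ν) (n : ℕ) : HasCuspOrder (fun τ ↦ f τ ^ n) (n * ν) := by
  induction n with
  | zero => simpa using const one_ne_zero
  | succ n ih =>
    have := ih.mul hf
    convert! this using 1
    push_cast
    ring

lemma zpow (hf : HasCuspOrder f ν) (n : ℤ) : HasCuspOrder (fun τ ↦ f τ ^ n) (n * ν) := by
  cases n with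
  | ofNat n => simpa using hf.pow n
  | negSucc n =>
    have := (hf.pow (n + 1)).inv
    convert! this using 1
    rw [Int.cast_negSucc]
    ring

lemma prod {ι : Type*} {s : Finset ι} {F : ι → ℍ → ℂ} {a : ι → ℝ}
    (h : ∀ i ∈ s, HasCuspOrder (F i) (a i)) :
    HasCuspOrder (fun τ ↦ ∏ i ∈ s, F i τ) (∑ i ∈ s, a i) := by
  classical
  induction s using Finset.induction_on with
  | empty => simpa using const one_ne_zero
  | insert i s hi ih =>
    simp only [Finset.prod_insert hi, Finset.sum_insert hi]
    exact (h i (Finset.mem_insert_self _ _)).mul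
      (ih fun j hj ↦ h j (Finset.mem_insert_of_mem hj))

lemma norm_exp_eq (ν : ℝ) (τ : ℍ) :
    ‖Complex.exp (2 * π * Complex.I * ν * τ)‖ = Real.exp (-(2 * π * ν * τ.im)) := by
  rw [Complex.norm_exp]
  congr 1
  simp [mul_assoc]

lemma tendsto_exp_atImInfty (hν : 0 < ν) :
    Tendsto (fun τ : ℍ ↦ Complex.exp (2 * π * Complex.I * ν * τ)) atImInfty (𝓝 0) := by
  rw [tendsto_zero_iff_norm_tendsto_zero]
  simp only [norm_exp_eq]
  refine Real.tendsto_exp_neg_atTop_nhds_zero.comp ?_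
  exact (tendsto_comap (f := im)).const_mul_atTop (by positivity)

lemma tendsto_zero (hf : HasCuspOrder f ν) (hν : 0 < ν) : Tendsto f atImInfty (𝓝 0) := by
  obtain ⟨c, -, h⟩ := hf
  have := h.mul (tendsto_exp_atImInfty hν)
  rw [mul_zero] at this
  refine this.congr fun τ ↦ ?_
  rw [mul_assoc, ← Complex.exp_add]
  simp

/-- The order at the cusp is well defined. -/
lemma unique (hf : HasCuspOrder f ν) (hf' : HasCuspOrder f μ) : ν = μ := by
  have key : ∀ {a b : ℝ}, HasCuspOrder f a → HasCuspOrder f b → ¬ a < b := by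
    intro a b ha hb hab
    have h1 := (hb.mul ha.inv).tendsto_zero (by linarith)
    obtain ⟨c, hc, h⟩ := ha
    have hne : ∀ᶠ τ in atImInfty, f τ ≠ 0 := by
      filter_upwards [h.eventually_ne hc] with τ hτ h0
      simp [h0] at hτ
    have : Tendsto (fun _ : ℍ ↦ (1 : ℂ)) atImInfty (𝓝 0) := by
      refine h1.congr' ?_
      filter_upwards [hne] with τ hτ
      exact mul_inv_cancel₀ hτ
    exact one_ne_zero (tendsto_nhds_unique tendsto_const_nhds this)
  exact le_antisymm (not_lt.mp (key hf' hf)) (not_lt.mp (key hf hf'))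

end HasCuspOrder

lemma hasCuspOrder_discriminant : HasCuspOrder ModularForm.discriminant 1 := by
  refine ⟨1, one_ne_zero, tendsto_discriminant_div_qParam.congr fun τ ↦ ?_⟩
  rw [div_eq_mul_inv, Periodic.qParam, ← Complex.exp_neg]
  simp

lemma hasCuspOrder_kleinJ_sub (c : ℂ) : HasCuspOrder (fun τ ↦ kleinJ τ - c) (-1) := by
  refine ⟨1, one_ne_zero, ?_⟩
  have h := tendsto_kleinJ_mul_qParam.sub
    ((qParam_tendsto_atImInfty (h := 1) one_pos).const_mul c)
  rw [mul_zero, sub_zero] at h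
  refine h.congr fun τ ↦ ?_
  rw [← sub_mul, Periodic.qParam]
  simp

end CuspOrder

/-! ### Orders at points of the upper half-plane. -/

section Orders

variable {f g : ℍ → ℂ} {z : ℍ}

lemma orderAt_mul (hf : MeromorphicAt (f ∘ ofComplex) z) (hg : MeromorphicAt (g ∘ ofComplex) z) :
    orderAt (fun τ ↦ f τ * g τ) z = orderAt f z + orderAt g z :=
  meromorphicOrderAt_mul hf hg

lemma orderAt_zpow (hf : MeromorphicAt (f ∘ ofComplex) z) (n : ℤ) :
    orderAt (fun τ ↦ f τ ^ n) z = n * orderAt f z :=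
  meromorphicOrderAt_zpow hf

lemma orderAt_prod {ι : Type*} {s : Finset ι} {F : ι → ℍ → ℂ}
    (hF : ∀ i, MeromorphicAt (F i ∘ ofComplex) z) :
    orderAt (fun τ ↦ ∏ i ∈ s, F i τ) z = ∑ i ∈ s, orderAt (F i) z := by
  rw [orderAt, ← meromorphicOrderAt_fun_prod fun i _ ↦ hF i]
  rfl

lemma det_coe_pos (γ : SL(2, ℤ)) : 0 < (γ : GL (Fin 2) ℝ).val.det := by
  rw [← Matrix.GeneralLinearGroup.val_det_apply]
  simp

lemma orderAt_smul (γ : SL(2, ℤ)) (f : ℍ → ℂ) (z : ℍ) :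
    orderAt (fun τ ↦ f (γ • τ)) z = orderAt f (γ • z) :=
  meromorphicOrderAt_comp_smul (f := f) (τ := z) (g := (γ : GL (Fin 2) ℝ)) (det_coe_pos γ)

lemma meromorphicAt_comp_smul (γ : SL(2, ℤ))
    (hf : MeromorphicAt (f ∘ ofComplex) (γ • z : ℍ)) :
    MeromorphicAt ((fun τ ↦ f (γ • τ)) ∘ ofComplex) z := by
  have ha := analyticAt_smul (g := (γ : GL (Fin 2) ℝ)) (det_coe_pos γ) z
  have e : ((fun τ ↦ f (γ • τ)) ∘ ofComplex) =
      (f ∘ ofComplex) ∘ fun w : ℂ ↦ (((γ : GL (Fin 2) ℝ) • ofComplex w : ℍ) : ℂ) := by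
    ext w
    simp
  rw [e]
  refine MeromorphicAt.comp_analyticAt ?_ ha
  simpa using hf

lemma analyticAt_denom_zpow (γ : SL(2, ℤ)) (k : ℤ) (z : ℍ) :
    AnalyticAt ℂ ((fun τ : ℍ ↦ denom γ τ ^ k) ∘ ofComplex) z :=
  analyticAt_comp_ofComplex (mdifferentiable_denom_zpow γ k) z

lemma meromorphicAt_slash (k : ℤ) (γ : SL(2, ℤ)) (hf : MeromorphicAt (f ∘ ofComplex) (γ • z : ℍ)) :
    MeromorphicAt ((f ∣[k] γ) ∘ ofComplex) z := by
  have e : f ∣[k] γ = fun τ ↦ f (γ • τ) * denom γ τ ^ (-k) :=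
    funext fun τ ↦ ModularForm.SL_slash_apply ..
  rw [e]
  exact (meromorphicAt_comp_smul γ hf).mul (analyticAt_denom_zpow γ (-k) z).meromorphicAt

lemma orderAt_slash (k : ℤ) (γ : SL(2, ℤ)) (hf : MeromorphicAt (f ∘ ofComplex) (γ • z : ℍ)) :
    orderAt (f ∣[k] γ) z = orderAt f (γ • z) := by
  have e : f ∣[k] γ = fun τ ↦ f (γ • τ) * denom γ τ ^ (-k) :=
    funext fun τ ↦ ModularForm.SL_slash_apply ..
  rw [e, orderAt_mul (meromorphicAt_comp_smul γ hf)
    (analyticAt_denom_zpow γ (-k) z).meromorphicAt, orderAt_smul,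
    orderAt_eq_zero (mdifferentiable_denom_zpow γ (-k)) (zpow_ne_zero _ (denom_ne_zero γ z)),
    add_zero]

/-- A function with a well-defined order at the cusp has neither zeros nor poles high up. -/
lemma HasCuspOrder.exists_orderAt_eq_zero {ν : ℝ} (hf : HasCuspOrder f ν)
    (hm : ∀ z : ℍ, MeromorphicAt (f ∘ ofComplex) z) :
    ∃ B : ℝ, ∀ z : ℍ, B ≤ z.im → orderAt f z = 0 := by
  obtain ⟨c, hc, h⟩ := hf
  -- The ball is bounded, which excludes a pole, and its closure omits 0, which excludes a zero.
  have hball : Metric.ball c (‖c‖ / 2) ∈ 𝓝 c := Metric.ball_mem_nhds _ (by positivity)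
  obtain ⟨B, hB⟩ := (atImInfty_mem _).mp (h.eventually hball)
  refine ⟨B + 1, fun z hz ↦ ?_⟩
  set E : ℍ → ℂ := fun τ ↦ Complex.exp (-(2 * π * Complex.I * ν * τ)) with hE
  have hEd : MDiff E := by
    rw [UpperHalfPlane.mdifferentiable_iff]
    have : DifferentiableOn ℂ (fun w : ℂ ↦ Complex.exp (-(2 * π * Complex.I * ν * w)))
        {z | 0 < z.im} := by fun_prop
    refine this.congr fun w hw ↦ ?_
    simp [hE, ofComplex_apply_of_im_pos hw]
  have hEm := (analyticAt_comp_ofComplex hEd z).meromorphicAt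
  have hord : orderAt (fun τ ↦ f τ * E τ) z = orderAt f z := by
    rw [orderAt_mul (hm z) hEm, orderAt_eq_zero hEd (Complex.exp_ne_zero _), add_zero]
  rw [← hord]
  have hev : ∀ᶠ w in 𝓝[≠] (z : ℂ), ((fun τ ↦ f τ * E τ) ∘ ofComplex) w ∈
      Metric.ball c (‖c‖ / 2) := by
    have : ∀ᶠ w in 𝓝 (z : ℂ), B < w.im ∧ 0 < w.im :=
      (Complex.continuous_im.continuousAt.eventually_const_lt (by simpa using by linarith)).and
        (isOpen_upperHalfPlaneSet.mem_nhds z.im_pos)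
    filter_upwards [this.filter_mono nhdsWithin_le_nhds] with w hw
    have := hB ⟨w, hw.2⟩ hw.1.le
    simpa [ofComplex_apply_of_im_pos hw.2] using this
  have hmer : MeromorphicAt ((fun τ ↦ f τ * E τ) ∘ ofComplex) z := (hm z).mul hEm
  rcases lt_trichotomy (orderAt (fun τ ↦ f τ * E τ) z) 0 with h0 | h0 | h0
  · have := tendsto_cobounded_of_meromorphicOrderAt_neg h0
    have hb := (Metric.isBounded_ball (x := c) (r := ‖c‖ / 2))
    obtain ⟨w, hw, hw'⟩ := (hev.and (this.eventually (Bornology.isBounded_def.mp hb))).exists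
    exact absurd hw hw'
  · exact h0
  · have := tendsto_zero_of_meromorphicOrderAt_pos h0
    have hmem : (0 : ℂ) ∈ Metric.closedBall c (‖c‖ / 2) :=
      Metric.isClosed_closedBall.mem_of_tendsto this
        (hev.mono fun w hw ↦ Metric.ball_subset_closedBall hw)
    rw [Metric.mem_closedBall, dist_zero_left] at hmem
    have := norm_pos_iff.mpr hc
    linarith

end Orders

/-! ### The valence formula in level one. -/

section LevelOne

variable {G : ℍ → ℂ} {μ : ℝ}

/-- `G` may take arbitrary values at isolated points; its meromorphic normal form does not. The
limit clause is what carries invariance and cusp behaviour from `G` over to `H`. -/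
lemma exists_holomorphic_of_orderAt_eq_zero (hm : ∀ z : ℍ, MeromorphicAt (G ∘ ofComplex) z)
    (h0 : ∀ z, orderAt G z = 0) :
    ∃ H : ℍ → ℂ, MDiff H ∧ (∀ z, H z ≠ 0) ∧
      ∀ z : ℍ, Tendsto (G ∘ ofComplex) (𝓝[≠] (z : ℂ)) (𝓝 (H z)) := by
  have hmo : MeromorphicOn (G ∘ ofComplex) upperHalfPlaneSet := fun w hw ↦ hm ⟨w, hw⟩
  set h := toMeromorphicNFOn (G ∘ ofComplex) upperHalfPlaneSet with hh
  have hnf : MeromorphicNFOn h upperHalfPlaneSet := meromorphicNFOn_toMeromorphicNFOn ..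
  have hord (z : ℍ) : meromorphicOrderAt h z = 0 := by
    rw [hh, meromorphicOrderAt_toMeromorphicNFOn hmo z.im_pos]
    exact h0 z
  have han (z : ℍ) : AnalyticAt ℂ h z :=
    (hnf z.im_pos).meromorphicOrderAt_nonneg_iff_analyticAt.mp (hord z).ge
  refine ⟨fun z ↦ h z, ?_, fun z ↦ (hnf z.im_pos).meromorphicOrderAt_eq_zero_iff.mp (hord z),
    fun z ↦ ?_⟩
  · rw [UpperHalfPlane.mdifferentiable_iff]
    have : DifferentiableOn ℂ h {z | 0 < z.im} := fun w hw ↦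
      (han ⟨w, hw⟩).differentiableAt.differentiableWithinAt
    refine this.congr fun w hw ↦ ?_
    simp [ofComplex_apply_of_im_pos hw]
  · have e := hmo.toMeromorphicNFOn_eq_self_on_nhdsNE z.im_pos
    exact ((han z).continuousAt.tendsto.mono_left nhdsWithin_le_nhds).congr' e

lemma tendsto_smul_nhdsNE (γ : SL(2, ℤ)) (z : ℍ) :
    Tendsto (fun w : ℂ ↦ ((γ • ofComplex w : ℍ) : ℂ)) (𝓝[≠] (z : ℂ)) (𝓝[≠] ((γ • z : ℍ) : ℂ)) := by
  have ha := analyticAt_smul (g := (γ : GL (Fin 2) ℝ)) (det_coe_pos γ) z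
  refine tendsto_nhdsWithin_iff.mpr ⟨?_, ?_⟩
  · have := ha.continuousAt.tendsto.mono_left (nhdsWithin_le_nhds (s := {(z : ℂ)}ᶜ))
    simpa using this
  · have : ∀ᶠ w in 𝓝[≠] (z : ℂ), 0 < w.im :=
      nhdsWithin_le_nhds (isOpen_upperHalfPlaneSet.mem_nhds z.im_pos)
    filter_upwards [this, self_mem_nhdsWithin] with w hw hwz h
    rw [Set.mem_singleton_iff, ← UpperHalfPlane.ext_iff] at h
    have heq : ofComplex w = z := MulAction.injective γ h
    rw [ofComplex_apply_of_im_pos hw] at heq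
    exact hwz (congrArg UpperHalfPlane.coe heq)

/-- A nonvanishing weight-zero modular function has order zero at the cusp: nonnegative case. -/
lemma not_pos_of_hasCuspOrder (hinv : ∀ (γ : SL(2, ℤ)) z, G (γ • z) = G z)
    (hm : ∀ z : ℍ, MeromorphicAt (G ∘ ofComplex) z) (h0 : ∀ z, orderAt G z = 0)
    (hμ : HasCuspOrder G μ) : ¬ 0 < μ := by
  intro hpos
  obtain ⟨H, hHd, hHne, hlim⟩ := exists_holomorphic_of_orderAt_eq_zero hm h0
  have hHinv (γ : SL(2, ℤ)) (z : ℍ) : H (γ • z) = H z := by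
    refine tendsto_nhds_unique (((hlim (γ • z)).comp (tendsto_smul_nhdsNE γ z)).congr fun w ↦ ?_)
      (hlim z)
    simp only [comp_apply, ofComplex_apply, hinv]
  have hslash (γ : SL(2, ℤ)) : H ∣[(0 : ℤ)] γ = H := by
    ext z
    rw [ModularForm.SL_slash_apply, neg_zero, zpow_zero, mul_one, hHinv]
  have hHzero : Tendsto H atImInfty (𝓝 0) := by
    have hG := hμ.tendsto_zero hpos
    rw [Metric.nhds_basis_closedBall.tendsto_right_iff] at hG ⊢
    intro ε hε
    obtain ⟨B, hB⟩ := (atImInfty_mem _).mp (hG ε hε)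
    refine (atImInfty_mem _).mpr ⟨B + 1, fun z hz ↦ ?_⟩
    refine Metric.isClosed_closedBall.mem_of_tendsto (hlim z) ?_
    have : ∀ᶠ w in 𝓝 (z : ℂ), B < w.im ∧ 0 < w.im :=
      (Complex.continuous_im.continuousAt.eventually_const_lt (by simpa using by linarith)).and
        (isOpen_upperHalfPlaneSet.mem_nhds z.im_pos)
    filter_upwards [this.filter_mono nhdsWithin_le_nhds] with w hw
    have := hB ⟨w, hw.2⟩ hw.1.le
    simpa [ofComplex_apply_of_im_pos hw.2] using this
  let M : ModularForm 𝒮ℒ 0 :=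
    { toFun := H
      slash_action_eq' := by
        rintro _ ⟨γ, rfl⟩
        exact hslash γ
      holo' := hHd
      bdd_at_cusps' := by
        intro c hc
        rw [Subgroup.IsArithmetic.isCusp_iff_isCusp_SL2Z] at hc
        rw [OnePoint.isBoundedAt_iff_forall_SL2Z hc]
        intro γ _
        rw [hslash γ]
        exact hHzero.isBigO_one ℝ }
  obtain ⟨c, hc⟩ := ModularFormClass.levelOne_weight_zero_const M
  have hc' : H = Function.const ℍ c := hc
  rw [hc'] at hHzero hHne
  exact hHne UpperHalfPlane.I (tendsto_nhds_unique tendsto_const_nhds hHzero)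

/-- The hypotheses are stable under `G ↦ G⁻¹`, which reverses the sign of `μ`. -/
lemma eq_zero_of_hasCuspOrder (hinv : ∀ (γ : SL(2, ℤ)) z, G (γ • z) = G z)
    (hm : ∀ z : ℍ, MeromorphicAt (G ∘ ofComplex) z) (h0 : ∀ z, orderAt G z = 0)
    (hμ : HasCuspOrder G μ) : μ = 0 := by
  have h1 := not_pos_of_hasCuspOrder hinv hm h0 hμ
  have h2 := not_pos_of_hasCuspOrder (G := fun z ↦ (G z)⁻¹) (fun γ z ↦ by rw [hinv])
    (fun z ↦ (hm z).inv) (fun z ↦ ?_) hμ.inv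
  · linarith
  · have : orderAt (fun z ↦ (G z)⁻¹) z = -orderAt G z := meromorphicOrderAt_inv
    rw [this, h0]
    rfl

/-- The valence formula for meromorphic modular forms of level one. The points of `S` are
inequivalent and represent all the zeros and poles of `F`. -/
theorem valence_formula_levelOne {K : ℤ} {F : ℍ → ℂ} {ν : ℝ}
    (hF : ∀ γ : SL(2, ℤ), F ∣[K] γ = F) (hm : ∀ z : ℍ, MeromorphicAt (F ∘ ofComplex) z)
    (htop : ∀ z, orderAt F z ≠ ⊤) (hν : HasCuspOrder F ν) (S : Finset ℍ)
    (hinj : Set.InjOn kleinJ S)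
    (hcov : ∀ z, orderAt F z ≠ 0 → ∃ s ∈ S, ∃ γ : SL(2, ℤ), z = γ • s) :
    ∑ s ∈ S, 2 * (ordAt F s : ℝ) / Nat.card (MulAction.stabilizer SL(2, ℤ) s) + ν = K / 12 := by
  choose e hdvd hpos hcard hord using exists_orderAt_kleinJ
  choose d hd using hdvd
  -- Since `e s * d s = 12` and `j - j(s)` has order `e s` at `s`, this factor has order `-12 *
  -- ordAt F s` there. The power 12 of `F` keeps the exponents integral and balances the weight
  -- against `Δ`.
  set P : ℍ → ℍ → ℂ := fun s τ ↦ (kleinJ τ - kleinJ s) ^ (-(d s : ℤ) * ordAt F s) with hP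
  set G : ℍ → ℂ := fun τ ↦ (F τ ^ (12 : ℤ) * ModularForm.discriminant τ ^ (-K)) *
    ∏ s ∈ S, P s τ with hG
  have hjm (c : ℂ) (z : ℍ) : MeromorphicAt ((fun τ ↦ kleinJ τ - c) ∘ ofComplex) z :=
    (analyticAt_comp_ofComplex
      (mdifferentiable_kleinJ.sub (mdifferentiable_const (c := c))) z).meromorphicAt
  have hΔm (z : ℍ) : MeromorphicAt (ModularForm.discriminant ∘ ofComplex) z :=
    (analyticAt_comp_ofComplex mdifferentiable_discriminant z).meromorphicAt
  have hPm (s z : ℍ) : MeromorphicAt (P s ∘ ofComplex) z := (hjm (kleinJ s) z).zpow _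
  have hFm (z : ℍ) : MeromorphicAt ((fun τ ↦ F τ ^ (12 : ℤ)) ∘ ofComplex) z := (hm z).zpow _
  have hΔm' (z : ℍ) : MeromorphicAt ((fun τ ↦ ModularForm.discriminant τ ^ (-K)) ∘ ofComplex) z :=
    (hΔm z).zpow _
  have hprodm (z : ℍ) : MeromorphicAt ((fun τ ↦ ∏ s ∈ S, P s τ) ∘ ofComplex) z := by
    have := MeromorphicAt.fun_prod (s := S) (F := fun s ↦ P s ∘ ofComplex) (x := (z : ℂ))
      fun s _ ↦ hPm s z
    exact this
  have hFΔm (z : ℍ) : MeromorphicAt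
      ((fun τ ↦ F τ ^ (12 : ℤ) * ModularForm.discriminant τ ^ (-K)) ∘ ofComplex) z :=
    (hFm z).mul (hΔm' z)
  have hcusp : HasCuspOrder G (12 * ν + (-K : ℤ) * 1 +
      ∑ s ∈ S, ((-(d s : ℤ) * ordAt F s : ℤ) : ℝ) * (-1)) := by
    refine HasCuspOrder.mul (HasCuspOrder.mul ?_ (hasCuspOrder_discriminant.zpow _))
      (HasCuspOrder.prod fun s _ ↦ (hasCuspOrder_kleinJ_sub _).zpow _)
    simpa using hν.zpow 12
  have hGinv (γ : SL(2, ℤ)) (z : ℍ) : G (γ • z) = G z := by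
    have h1 := apply_smul_of_slash_eq (hF γ) z
    have h2 := apply_smul_of_slash_eq (discriminant_slash γ) z
    have hd0 : denom γ z ≠ 0 := denom_ne_zero γ z
    simp only [hG, hP, kleinJ_smul, h1, h2]
    congr 1
    rw [mul_zpow, mul_zpow, ← zpow_mul, ← zpow_mul, mul_mul_mul_comm, ← zpow_add₀ hd0]
    rw [show K * 12 + 12 * -K = 0 by ring, zpow_zero, mul_one]
  have hG0 (z : ℍ) : orderAt G z = 0 := by
    rw [hG, orderAt_mul (hFΔm z) (hprodm z), orderAt_mul (hFm z) (hΔm' z),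
      orderAt_zpow (hm z), orderAt_zpow (hΔm z),
      orderAt_eq_zero mdifferentiable_discriminant (discriminant_ne_zero z), mul_zero, add_zero,
      orderAt_prod fun s ↦ hPm s z]
    have hPo (s : ℍ) : orderAt (P s) z = ((-(d s : ℤ) * ordAt F s : ℤ) : WithTop ℤ) *
        orderAt (fun τ ↦ kleinJ τ - kleinJ s) z := orderAt_zpow (hjm _ _) _
    have hne (s : ℍ) (hs : kleinJ z ≠ kleinJ s) : orderAt (P s) z = 0 := by
      rw [hPo, orderAt_kleinJ_sub_of_ne hs, mul_zero]
    by_cases hz : ∃ s ∈ S, kleinJ z = kleinJ s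
    · obtain ⟨s, hs, hzs⟩ := hz
      rw [Finset.sum_eq_single_of_mem s hs fun t ht hts ↦ hne t fun h ↦
        hts (hinj ht hs (h.symm.trans hzs)), hPo, hord s z hzs]
      obtain ⟨γ, rfl⟩ := exists_smul_eq_of_kleinJ_eq hzs.symm
      have : orderAt F (γ • s) = orderAt F s := by
        rw [← orderAt_slash K γ (hm _), hF]
      rw [this]
      obtain ⟨n, hn⟩ := WithTop.ne_top_iff_exists.mp (htop s)
      have hn' : ordAt F s = n := by
        rw [ordAt, show meromorphicOrderAt (F ∘ ofComplex) (s : ℂ) = n from hn.symm]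
        rfl
      rw [hn', ← hn]
      have : (12 : ℤ) * n + (-(d s : ℤ) * n) * (e s : ℤ) = 0 := by
        have := hd s
        have : (12 : ℤ) = e s * d s := by exact_mod_cast this
        rw [this]
        ring
      exact congrArg (WithTop.some) this
    · push Not at hz
      have hz0 : orderAt F z = 0 := by
        by_contra h
        obtain ⟨s, hs, γ, rfl⟩ := hcov z h
        exact hz s hs (kleinJ_smul γ s)
      rw [hz0, mul_zero, zero_add]
      exact Finset.sum_eq_zero fun s hs ↦ hne s (hz s hs)
  have := eq_zero_of_hasCuspOrder hGinv (fun z ↦ (hFΔm z).mul (hprodm z)) hG0 hcusp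
  have hsum : ∑ s ∈ S, 2 * (ordAt F s : ℝ) / Nat.card (MulAction.stabilizer SL(2, ℤ) s) =
      (∑ s ∈ S, ((-(d s : ℤ) * ordAt F s : ℤ) : ℝ) * (-1)) / 12 := by
    rw [Finset.sum_div]
    refine Finset.sum_congr rfl fun s _ ↦ ?_
    have h12 : (12 : ℝ) = e s * d s := by exact_mod_cast hd s
    have he : (e s : ℝ) ≠ 0 := by exact_mod_cast (hpos s).ne'
    have hd0 : (d s : ℝ) ≠ 0 := fun h ↦ by rw [h] at h12; norm_num at h12
    rw [hcard, h12]
    push_cast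
    field_simp
  rw [hsum]
  push_cast at this ⊢
  linarith

end LevelOne

/-! ### Counting cosets by orbits. -/

section OrbitCounting

variable {Γ X : Type*} [Group Γ] [MulAction Γ X] (H : Subgroup Γ)

/-- The number of cosets `gH` such that `g⁻¹ • s` lies in the `H`-orbit of `y`, for `s` in the
`Γ`-orbit of `y`. -/
lemma ncard_cosets_mul_card_stabilizer {s y : X} {γ : Γ} (hγ : s = γ • y) :
    {q : Γ ⧸ H | ∃ h ∈ H, q.out⁻¹ • s = h • y}.ncard * Nat.card (MulAction.stabilizer H y) =
      Nat.card (MulAction.stabilizer Γ s) := by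
  -- These cosets form one orbit of the stabilizer of `s` in `Γ`; the isotropy group of `γH` in it
  -- is conjugate by `γ` to the stabilizer of `y` in `H`.
  have horbit : {q : Γ ⧸ H | ∃ h ∈ H, q.out⁻¹ • s = h • y} =
      MulAction.orbit (MulAction.stabilizer Γ s) (γ : Γ ⧸ H) := by
    ext q
    constructor
    · rintro ⟨h, hh, e⟩
      refine ⟨⟨q.out * h * γ⁻¹, ?_⟩, ?_⟩
      · rw [MulAction.mem_stabilizer_iff, mul_smul, mul_smul, hγ, inv_smul_smul, ← e, ← hγ,
          smul_inv_smul]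
      · change ((q.out * h * γ⁻¹ * γ : Γ) : Γ ⧸ H) = q
        rw [inv_mul_cancel_right, QuotientGroup.mk_mul_of_mem _ hh, QuotientGroup.out_eq']
    · rintro ⟨⟨t, ht⟩, rfl⟩
      obtain ⟨h, hh⟩ := QuotientGroup.mk_out_eq_mul H (t * γ)
      refine ⟨(h : Γ)⁻¹, inv_mem h.2, ?_⟩
      change ((t * γ : Γ) : Γ ⧸ H).out⁻¹ • s = _
      rw [hh, mul_inv_rev, mul_inv_rev, mul_smul, mul_smul,
        show t⁻¹ • s = s from (MulAction.stabilizer Γ s).inv_mem ht, hγ, inv_smul_smul]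
  have hstab : Nat.card (MulAction.stabilizer (MulAction.stabilizer Γ s) (γ : Γ ⧸ H)) =
      Nat.card (MulAction.stabilizer H y) := by
    have key (t : Γ) : t • (γ : Γ ⧸ H) = γ ↔ γ⁻¹ * t * γ ∈ H := by
      rw [eq_comm, MulAction.Quotient.smul_coe, QuotientGroup.eq, smul_eq_mul, mul_assoc]
    refine Nat.card_congr
      { toFun := fun t ↦ ⟨⟨γ⁻¹ * t.1.1 * γ, (key _).mp t.2⟩, ?_⟩
        invFun := fun h ↦ ⟨⟨γ * h.1.1 * γ⁻¹, ?_⟩, (key _).mpr ?_⟩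
        left_inv := fun t ↦ by ext; simp [mul_assoc]
        right_inv := fun t ↦ by ext; simp [mul_assoc] }
    · change (γ⁻¹ * t.1.1 * γ) • y = y
      rw [mul_smul, mul_smul, ← hγ, show t.1.1 • s = s from t.1.2, hγ, inv_smul_smul]
    · change (γ * h.1.1 * γ⁻¹) • s = s
      rw [mul_smul, mul_smul, hγ, inv_smul_smul, show h.1.1 • y = y from h.2]
    · simp [mul_assoc]
  rw [horbit, ← MulAction.index_stabilizer, ← hstab, mul_comm, Subgroup.card_mul_index]

lemma ncard_range_zpow_smul [Finite X] (a : Γ) (b : X) :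
    (Set.range fun n : ℤ ↦ a ^ n • b).ncard = minimalPeriod (a • ·) b := by
  have : Fintype (MulAction.orbit (Subgroup.zpowers a) b) := Fintype.ofFinite _
  rw [MulAction.minimalPeriod_eq_card, ← Nat.card_eq_fintype_card, Nat.card_coe_set_eq]
  congr 1
  ext x
  constructor
  · rintro ⟨n, rfl⟩
    exact ⟨⟨_, n, rfl⟩, rfl⟩
  · rintro ⟨⟨_, n, rfl⟩, rfl⟩
    exact ⟨n, rfl⟩

end OrbitCounting

/-! ### Cusps and their widths. -/

section CuspCounting

variable {N : ℕ}

lemma neg_one_mem_Gamma0 (N : ℕ) : (-1 : SL(2, ℤ)) ∈ Gamma0 N := by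
  simp [Gamma0_mem]

lemma eq_T_zpow_or_neg_of_lower_left_eq_zero {g : SL(2, ℤ)} (hc : g 1 0 = 0) :
    ∃ n : ℤ, g = ModularGroup.T ^ n ∨ g = -ModularGroup.T ^ n := by
  have had := g.det_coe
  replace had : g 0 0 * g 1 1 = 1 := by rw [Matrix.det_fin_two, hc] at had; linarith
  rcases Int.eq_one_or_neg_one_of_mul_eq_one' had with (⟨ha, hd⟩ | ⟨ha, hd⟩)
  · refine ⟨g 0 1, Or.inl ?_⟩
    ext i j
    fin_cases i <;> fin_cases j <;> simp [ha, hc, hd, ModularGroup.coe_T_zpow]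
  · refine ⟨-g 0 1, Or.inr ?_⟩
    ext i j
    fin_cases i <;> fin_cases j <;> simp [ha, hc, hd, ModularGroup.coe_T_zpow]

lemma mapGL_smul_infty_iff (g : SL(2, ℤ)) :
    Matrix.SpecialLinearGroup.mapGL ℚ g • (OnePoint.infty : OnePoint ℚ) = OnePoint.infty ↔
      g 1 0 = 0 := by
  rw [OnePoint.smul_infty_eq_self_iff]
  simp

/-- The stabilizer of `i∞` in `SL(2, ℤ)` consists of the `±T ^ n`, and the sign is absorbed by `-1 ∈
Γ₀(N)`. -/
lemma cuspOf_eq_iff {σ σ' : SL(2, ℤ)} :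
    cuspOf N σ = cuspOf N σ' ↔ ∃ h ∈ Gamma0 N, ∃ n : ℤ,
      σ = h * σ' * ModularGroup.T ^ n := by
  rw [cuspOf, cuspOf, Quotient.eq, MulAction.orbitRel_apply, MulAction.mem_orbit_iff]
  constructor
  · rintro ⟨⟨g, hg⟩, e⟩
    obtain ⟨h, hh, rfl⟩ := Subgroup.mem_map.mp hg
    rw [Subgroup.mk_smul] at e
    have e' : Matrix.SpecialLinearGroup.mapGL ℚ ((h * σ')⁻¹ * σ) •
        (OnePoint.infty : OnePoint ℚ) = OnePoint.infty := by
      rw [map_mul, mul_smul, ← e, map_inv, map_mul, mul_inv_rev, mul_smul, inv_smul_smul,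
        inv_smul_smul]
    rw [mapGL_smul_infty_iff] at e'
    obtain ⟨n, hn | hn⟩ := eq_T_zpow_or_neg_of_lower_left_eq_zero e'
    · refine ⟨h, hh, n, ?_⟩
      rw [← hn, mul_inv_cancel_left]
    · refine ⟨-1 * h, mul_mem (neg_one_mem_Gamma0 N) hh, n, ?_⟩
      have : σ = (h * σ') * -ModularGroup.T ^ n := by rw [← hn, mul_inv_cancel_left]
      rw [this]
      simp
  · rintro ⟨h, hh, n, rfl⟩
    refine ⟨⟨_, Subgroup.mem_map_of_mem _ hh⟩, ?_⟩
    rw [Subgroup.mk_smul]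
    have : Matrix.SpecialLinearGroup.mapGL ℚ (ModularGroup.T ^ n) •
        (OnePoint.infty : OnePoint ℚ) = OnePoint.infty := by
      rw [mapGL_smul_infty_iff]
      simp [ModularGroup.coe_T_zpow]
    rw [map_mul, map_mul, mul_smul, mul_smul, this]

lemma cuspOf_surjective (N : ℕ) : Surjective (cuspOf N) := by
  rintro ⟨c⟩
  obtain ⟨g, hg⟩ := OnePoint.exists_mem_SL2 ℤ c
  exact ⟨g, congrArg (Quotient.mk _) hg⟩

lemma coset_zpow_smul_eq_iff (σ : SL(2, ℤ)) (n : ℤ) :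
    ModularGroup.T ^ n • ((σ⁻¹ : SL(2, ℤ)) : SL(2, ℤ) ⧸ Gamma0 N) = (σ⁻¹ : SL(2, ℤ)) ↔
      σ * ModularGroup.T ^ n * σ⁻¹ ∈ Gamma0 N := by
  rw [eq_comm, MulAction.Quotient.smul_coe, QuotientGroup.eq, smul_eq_mul, mul_assoc, inv_inv]

/-- The cosets `gΓ₀(N)` for which `g⁻¹(i∞)` represents a given cusp are permuted transitively by
the translations. -/
lemma setOf_cuspOf_eq_range (σ : SL(2, ℤ)) :
    {q : SL(2, ℤ) ⧸ Gamma0 N | cuspOf N q.out⁻¹ = cuspOf N σ} =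
      Set.range fun n : ℤ ↦
        ModularGroup.T ^ n • ((σ⁻¹ : SL(2, ℤ)) : SL(2, ℤ) ⧸ Gamma0 N) := by
  ext q
  rw [Set.mem_ofPred_eq, cuspOf_eq_iff]
  constructor
  · rintro ⟨h, hh, n, e⟩
    refine ⟨-n, ?_⟩
    change ((ModularGroup.T ^ (-n) * σ⁻¹ : SL(2, ℤ)) : SL(2, ℤ) ⧸ Gamma0 N) = q
    rw [← QuotientGroup.out_eq' q, QuotientGroup.eq, show q.out = (q.out⁻¹)⁻¹ by simp, e]
    simpa [mul_assoc] using hh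
  · rintro ⟨n, rfl⟩
    obtain ⟨h, hh⟩ := QuotientGroup.mk_out_eq_mul (Gamma0 N) (ModularGroup.T ^ n * σ⁻¹)
    refine ⟨(h : SL(2, ℤ))⁻¹, inv_mem h.2, -n, ?_⟩
    change ((ModularGroup.T ^ n * σ⁻¹ : SL(2, ℤ)) : SL(2, ℤ) ⧸ Gamma0 N).out⁻¹ = _
    rw [hh]
    simp [mul_assoc]

/-- The cosets form a cyclic orbit under `T`, whose length is the least period of `σ⁻¹Γ₀(N)`; fixing
that coset by `T ^ h` is the condition defining the width. -/
lemma ncard_setOf_cuspOf_eq (hN : 0 < N) (σ : SL(2, ℤ)) :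
    {q : SL(2, ℤ) ⧸ Gamma0 N | cuspOf N q.out⁻¹ = cuspOf N σ}.ncard = cuspWidth N σ := by
  have : NeZero N := ⟨hN.ne'⟩
  rw [setOf_cuspOf_eq_range, ncard_range_zpow_smul, cuspWidth]
  have hper (h : ℕ) : IsPeriodicPt (ModularGroup.T • ·)
      h ((σ⁻¹ : SL(2, ℤ)) : SL(2, ℤ) ⧸ Gamma0 N) ↔ σ * ModularGroup.T ^ h * σ⁻¹ ∈ Gamma0 N := by
    rw [← zpow_natCast, ← coset_zpow_smul_eq_iff, IsPeriodicPt, smul_iterate, IsFixedPt,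
      zpow_natCast]
  have hpos : 0 < minimalPeriod (ModularGroup.T • ·)
      ((σ⁻¹ : SL(2, ℤ)) : SL(2, ℤ) ⧸ Gamma0 N) := by
    rw [← ncard_range_zpow_smul, Set.ncard_pos]
    exact Set.range_nonempty _
  refine le_antisymm (le_csInf ⟨_, hpos, (hper _).mp (isPeriodicPt_minimalPeriod _ _)⟩ ?_)
    (Nat.sInf_le ⟨hpos, (hper _).mp (isPeriodicPt_minimalPeriod _ _)⟩)
  rintro h ⟨h0, hh⟩
  exact ((hper h).mpr hh).minimalPeriod_le h0

lemma cuspWidth_pos (hN : 0 < N) (σ : SL(2, ℤ)) : 0 < cuspWidth N σ := by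
  have : NeZero N := ⟨hN.ne'⟩
  rw [← ncard_setOf_cuspOf_eq hN, Set.ncard_pos, setOf_cuspOf_eq_range]
  exact Set.range_nonempty _

lemma T_pow_cuspWidth_mem (hN : 0 < N) (σ : SL(2, ℤ)) :
    σ * ModularGroup.T ^ cuspWidth N σ * σ⁻¹ ∈ Gamma0 N := by
  have hpos := cuspWidth_pos hN σ
  exact (Nat.sInf_mem (Nat.nonempty_of_pos_sInf hpos)).2

lemma finite_cuspSet (hN : 0 < N) : Finite (CuspSet N) := by
  have : NeZero N := ⟨hN.ne'⟩
  refine Finite.of_surjective (fun q : SL(2, ℤ) ⧸ Gamma0 N ↦ cuspOf N q.out⁻¹) fun ρ ↦ ?_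
  obtain ⟨σ, rfl⟩ := cuspOf_surjective N ρ
  have : ((σ⁻¹ : SL(2, ℤ)) : SL(2, ℤ) ⧸ Gamma0 N) ∈
      {q : SL(2, ℤ) ⧸ Gamma0 N | cuspOf N q.out⁻¹ = cuspOf N σ} := by
    rw [setOf_cuspOf_eq_range]
    exact ⟨0, by simp⟩
  exact ⟨_, this⟩

end CuspCounting

/-! ### Passing to the quotient by `±I`. -/

section Stabilizers

variable {N : ℕ}

/-- The projection from `SL(2, ℤ)` to `PGL(2, ℝ)`. -/
abbrev toPGLReal : SL(2, ℤ) →* PGL(2, ℝ) :=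
  Matrix.ProjGenLinGroup.mk.comp (Matrix.SpecialLinearGroup.mapGL ℝ)

lemma toPGLReal_smul (γ : SL(2, ℤ)) (z : ℍ) : toPGLReal γ • z = γ • z :=
  pglMk_smul _ _

lemma toPGLReal_eq_one_iff {γ : SL(2, ℤ)} : toPGLReal γ = 1 ↔ γ = 1 ∨ γ = -1 := by
  constructor
  · intro h
    have hact (z : ℍ) : γ • z = z := by rw [← toPGLReal_smul, h, one_smul]
    -- An element acting trivially fixes the interior point `2i` of `𝒟`, and only `±1` does.
    have hz : (⟨2 * Complex.I, by simp⟩ : ℍ) ∈ 𝒟ᵒ := by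
      constructor <;> norm_num [UpperHalfPlane.re, Complex.normSq_apply]
    exact ModularGroup.eq_one_or_neg_one_of_mem_fdo_mem_fdo hz (by rwa [hact])
  · rintro (rfl | rfl)
    · exact map_one _
    · refine eq_of_smul_eq_smul fun z : ℍ ↦ ?_
      rw [toPGLReal_smul, one_smul]
      simp

/-- The stabilizer of a point in `Γ₀(N)` is a twofold cover of its image modulo `±I`. -/
lemma card_stabilizer_Gamma0 (N : ℕ) (z : ℍ) :
    Nat.card (MulAction.stabilizer (Gamma0 N) z) = 2 * stabOrder N z := by
  let φ : MulAction.stabilizer (Gamma0 N) z →* MulAction.stabilizer (Gamma0Bar N) z :=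
    { toFun := fun γ ↦ ⟨⟨toPGLReal γ.1.1, ⟨γ.1.1, γ.1.2, rfl⟩⟩, by
        change toPGLReal γ.1.1 • z = z
        rw [toPGLReal_smul]
        exact γ.2⟩
      map_one' := by ext1; ext1; exact map_one _
      map_mul' := fun a b ↦ by ext1; ext1; exact map_mul toPGLReal a.1.1 b.1.1 }
  have hφ : Surjective φ := by
    rintro ⟨⟨_, γ, hγ, rfl⟩, h⟩
    refine ⟨⟨⟨γ, hγ⟩, ?_⟩, rfl⟩
    have h' : toPGLReal γ • z = z := h
    rwa [toPGLReal_smul] at h'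
  have hker : Nat.card φ.ker = 2 := by
    have h1 : (1 : SL(2, ℤ)) ≠ -1 := by decide
    let n : MulAction.stabilizer (Gamma0 N) z := ⟨⟨-1, neg_one_mem_Gamma0 N⟩, by
      change (-1 : SL(2, ℤ)) • z = z
      simp⟩
    have : (φ.ker : Set (MulAction.stabilizer (Gamma0 N) z)) = {1, n} := by
      ext γ
      have : γ ∈ φ.ker ↔ toPGLReal γ.1.1 = 1 := by
        rw [MonoidHom.mem_ker, Subtype.ext_iff, Subtype.ext_iff]
        rfl
      rw [SetLike.mem_coe, this, toPGLReal_eq_one_iff, Set.mem_insert_iff,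
        Set.mem_singleton_iff, Subtype.ext_iff, Subtype.ext_iff, Subtype.ext_iff, Subtype.ext_iff]
      rfl
    rw [← SetLike.coe_sort_coe, Nat.card_coe_set_eq, this, Set.ncard_pair]
    intro h
    exact h1 (congrArg (fun γ ↦ γ.1.1) h)
  rw [← Subgroup.card_mul_index φ.ker, hker, Subgroup.index_ker, stabOrder,
    MonoidHom.range_eq_top.mpr hφ, Subgroup.card_top]

end Stabilizers

/-! ### The norm to level one and the valence formula for `Γ₀(N)`. -/

section ModularForms

variable {N : ℕ} {k : ℤ} {f : ℍ → ℂ}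

lemma orderAt_ne_top (hm : ∀ z : ℍ, MeromorphicAt (f ∘ ofComplex) z) (hf0 : IsNonzero f) (z : ℍ) :
    orderAt f z ≠ ⊤ := by
  obtain ⟨w, hw⟩ := hf0
  have hmo : MeromorphicOn (f ∘ ofComplex) upperHalfPlaneSet := fun w hw ↦ hm ⟨w, hw⟩
  have hconv : Convex ℝ upperHalfPlaneSet := convex_halfSpace_im_gt 0
  exact hmo.meromorphicOrderAt_ne_top_of_isPreconnected hconv.isPreconnected w.im_pos z.im_pos hw

lemma finite_setOf_orderAt_ne_zero (hm : ∀ z : ℍ, MeromorphicAt (f ∘ ofComplex) z)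
    (htop : ∀ z, orderAt f z ≠ ⊤) {K : Set ℍ} (hK : IsCompact K) :
    {z ∈ K | orderAt f z ≠ 0}.Finite := by
  have hKc : IsCompact (UpperHalfPlane.coe '' K) := hK.image continuous_coe
  have hmo : MeromorphicOn (f ∘ ofComplex) (UpperHalfPlane.coe '' K) := by
    rintro _ ⟨z, -, rfl⟩
    exact hm z
  have hfin := (MeromorphicOn.divisor (f ∘ ofComplex) (UpperHalfPlane.coe '' K)).finiteSupport hKc
  refine Set.Finite.subset (hfin.preimage (f := UpperHalfPlane.coe)
    fun z _ w _ h ↦ UpperHalfPlane.ext h) ?_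
  rintro z ⟨hz, h0⟩
  rw [Set.mem_preimage, Function.mem_support,
    MeromorphicOn.divisor_apply hmo (Set.mem_image_of_mem _ hz)]
  simpa [htop z] using h0

lemma denom_T_zpow (n : ℤ) (z : ℍ) : denom (ModularGroup.T ^ n : SL(2, ℤ)) z = 1 := by
  rw [ModularGroup.denom_apply, ModularGroup.coe_T_zpow]
  simp

lemma ordAt_eq_of_orderAt_eq {g : ℍ → ℂ} {z w : ℍ} (h : orderAt f z = orderAt g w) :
    ordAt f z = ordAt g w := congrArg WithTop.untop₀ h

namespace IsMeromorphicModularForm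

lemma slash_periodic (hf : IsMeromorphicModularForm N k f) (hN : 0 < N) (σ : SL(2, ℤ)) :
    Periodic ((f ∣[k] σ) ∘ ofComplex) (cuspWidth N σ) := by
  set h := cuspWidth N σ
  have hslash : (f ∣[k] σ) ∣[k] (ModularGroup.T ^ (h : ℤ)) = f ∣[k] σ := by
    have := hf.slash_eq _ (T_pow_cuspWidth_mem hN σ)
    nth_rewrite 2 [← this]
    rw [← SlashAction.slash_mul, ← SlashAction.slash_mul, zpow_natCast, inv_mul_cancel_right]
  have hz (z : ℍ) : (f ∣[k] σ) (ModularGroup.T ^ (h : ℤ) • z) = (f ∣[k] σ) z := by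
    rw [apply_smul_of_slash_eq hslash]
    rw [denom_T_zpow, one_zpow, mul_one]
  intro w
  by_cases hw : 0 < w.im
  · have hw' : 0 < (w + h).im := by simpa using hw
    have := hz ⟨w, hw⟩
    simp only [comp_apply, ofComplex_apply_of_im_pos hw, ofComplex_apply_of_im_pos hw']
    rw [← this]
    refine congrArg _ (UpperHalfPlane.ext ?_)
    rw [ModularGroup.coe_T_zpow_smul_eq]
    simp
  -- Outside the half-plane `ofComplex` takes a constant default value, so periodicity is automatic.
  · have hw' : ¬ 0 < (w + h).im := by simpa using hw
    simp only [comp_apply]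
    rw [ofComplex_apply_of_im_nonpos (not_lt.mp hw), ofComplex_apply_of_im_nonpos (not_lt.mp hw')]

lemma meromorphicAt_slash (hf : IsMeromorphicModularForm N k f) (σ : SL(2, ℤ)) (z : ℍ) :
    MeromorphicAt ((f ∣[k] σ) ∘ ofComplex) z :=
  ValenceFormula.meromorphicAt_slash k σ (hf.meromorphic _)

lemma orderAt_slash (hf : IsMeromorphicModularForm N k f) (σ : SL(2, ℤ)) (z : ℍ) :
    orderAt (f ∣[k] σ) z = orderAt f (σ • z) :=
  ValenceFormula.orderAt_slash k σ (hf.meromorphic _)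

lemma orderAt_smul (hf : IsMeromorphicModularForm N k f) {γ : SL(2, ℤ)} (hγ : γ ∈ Gamma0 N)
    (z : ℍ) : orderAt f (γ • z) = orderAt f z := by
  rw [← hf.orderAt_slash, hf.slash_eq γ hγ]

/-- The local parameter is `exp(2πiτ/ℓ)`, so its `n`-th power has exponent `n/ℓ`. The order is
finite, since otherwise `f` would vanish identically near some point. -/
lemma hasCuspOrder_slash (hf : IsMeromorphicModularForm N k f) (hf0 : IsNonzero f) (hN : 0 < N)
    (σ : SL(2, ℤ)) :
    HasCuspOrder (f ∣[k] σ) (ordAtCusp N k f σ / cuspWidth N σ) := by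
  have hw : (0 : ℝ) < cuspWidth N σ := by exact_mod_cast cuspWidth_pos hN σ
  have heq (τ : ℍ) : cuspExpansion N k f σ (𝕢 (cuspWidth N σ) τ) = (f ∣[k] σ) τ :=
    UpperHalfPlane.eq_cuspFunction τ hw.ne' (hf.slash_periodic hN σ)
  have hlim : Tendsto (fun τ : ℍ ↦ 𝕢 (cuspWidth N σ) τ) atImInfty (𝓝[≠] 0) :=
    (Periodic.qParam_tendsto hw).comp tendsto_coe_atImInfty
  have htop : meromorphicOrderAt (cuspExpansion N k f σ) 0 ≠ ⊤ := by
    intro h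
    have h0 : ∀ᶠ τ in atImInfty, (f ∣[k] σ) τ = 0 :=
      (hlim.eventually (meromorphicOrderAt_eq_top_iff.mp h)).mono fun τ hτ ↦ by rw [← heq, hτ]
    obtain ⟨B, hB⟩ := (atImInfty_mem _).mp h0
    let z : ℍ := ⟨(max B 0 + 1 : ℝ) * Complex.I, by simp; positivity⟩
    refine orderAt_ne_top hf.meromorphic hf0 (σ • z) ?_
    rw [← hf.orderAt_slash, orderAt, meromorphicOrderAt_eq_top_iff]
    have hev : ∀ᶠ w in 𝓝 (z : ℂ), B < w.im ∧ 0 < w.im := by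
      refine (Complex.continuous_im.continuousAt.eventually_const_lt ?_).and
        (isOpen_upperHalfPlaneSet.mem_nhds z.im_pos)
      have : (z : ℂ).im = max B 0 + 1 := by simp [z]
      rw [this]
      linarith [le_max_left B 0]
    filter_upwards [hev.filter_mono nhdsWithin_le_nhds] with w hw
    rw [comp_apply, ofComplex_apply_of_im_pos hw.2]
    exact hB ⟨w, hw.2⟩ hw.1.le
  have hn : meromorphicOrderAt (cuspExpansion N k f σ) 0 = ordAtCusp N k f σ :=
    (WithTop.coe_untop₀_of_ne_top htop).symm
  obtain ⟨g, hg, hg0, he⟩ := (meromorphicOrderAt_eq_int_iff (hf.meromorphic_cusp σ)).mp hn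
  refine ⟨g 0, hg0, ((hg.continuousAt.tendsto.mono_left nhdsWithin_le_nhds).comp hlim).congr' ?_⟩
  filter_upwards [hlim.eventually he] with τ hτ
  rw [← heq, hτ, sub_zero, smul_eq_mul, comp_apply, mul_right_comm, Periodic.qParam,
    ← Complex.exp_int_mul, ← Complex.exp_add]
  rw [show (ordAtCusp N k f σ : ℂ) * (2 * π * Complex.I * τ / (cuspWidth N σ : ℝ)) +
    -(2 * π * Complex.I * (ordAtCusp N k f σ / cuspWidth N σ : ℝ) * τ) = 0 by push_cast; ring]
  simp

lemma slash_inv_eq_of_mk_eq (hf : IsMeromorphicModularForm N k f) {g g' : SL(2, ℤ)}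
    (h : (g : SL(2, ℤ) ⧸ Gamma0 N) = g') : f ∣[k] g⁻¹ = f ∣[k] g'⁻¹ := by
  rw [QuotientGroup.eq] at h
  have := hf.slash_eq _ (inv_mem h)
  nth_rewrite 1 [← this]
  rw [← SlashAction.slash_mul, mul_inv_rev, inv_inv, mul_inv_cancel_right]

/-- Replacing `σ'` by `γ σ' T ^ n` only translates the variable, which multiplies the leading
constant by a root-like factor `exp(2πiνn)` and leaves the exponent `ν` unchanged. -/
lemma cuspOrder_eq (hf : IsMeromorphicModularForm N k f) (hf0 : IsNonzero f) (hN : 0 < N)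
    {σ σ' : SL(2, ℤ)} (h : cuspOf N σ = cuspOf N σ') :
    (ordAtCusp N k f σ / cuspWidth N σ : ℝ) = ordAtCusp N k f σ' / cuspWidth N σ' := by
  obtain ⟨γ, hγ, n, rfl⟩ := cuspOf_eq_iff.mp h
  refine (hf.hasCuspOrder_slash hf0 hN _).unique ?_
  obtain ⟨c, hc, hlim⟩ := hf.hasCuspOrder_slash hf0 hN σ'
  set ν : ℝ := ordAtCusp N k f σ' / cuspWidth N σ'
  have hslash (τ : ℍ) : (f ∣[k] (γ * σ' * ModularGroup.T ^ n)) τ =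
      (f ∣[k] σ') (ModularGroup.T ^ n • τ) := by
    rw [SlashAction.slash_mul, SlashAction.slash_mul, hf.slash_eq γ hγ, ModularForm.SL_slash_apply]
    rw [denom_T_zpow, one_zpow, mul_one]
  refine ⟨c * Complex.exp (2 * π * Complex.I * ν * n), mul_ne_zero hc (Complex.exp_ne_zero _), ?_⟩
  have hT : Tendsto (fun τ : ℍ ↦ ModularGroup.T ^ n • τ) atImInfty atImInfty := by
    refine tendsto_comap_iff.mpr (tendsto_comap.congr fun τ ↦ ?_)
    exact (ModularGroup.im_T_zpow_smul τ n).symm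
  refine ((hlim.comp hT).mul_const _).congr fun τ ↦ ?_
  rw [hslash, comp_apply, mul_assoc, ← Complex.exp_add, ModularGroup.coe_T_zpow_smul_eq]
  ring_nf

end IsMeromorphicModularForm

/-- Regrouping a sum over cosets and level-one points as a sum over the orbits of `Γ₀(N)`. -/
lemma finite_and_sum_cosets_eq_finsum [Fintype (SL(2, ℤ) ⧸ Gamma0 N)] {φ : ℍ → ℝ}
    (hφ : ∀ γ ∈ Gamma0 N, ∀ z, φ (γ • z) = φ z) {S : Finset ℍ} (hinj : Set.InjOn kleinJ S)
    (hcov : ∀ y, φ y ≠ 0 → ∃ s ∈ S, ∃ γ : SL(2, ℤ), y = γ • s)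
    {rep : OpenModularCurve N → ℍ} (hrep : ∀ x, Quotient.mk _ (rep x) = x) :
    {x | φ (rep x) ≠ 0}.Finite ∧
      ∑ s ∈ S, 2 * (∑ q : SL(2, ℤ) ⧸ Gamma0 N, φ (q.out⁻¹ • s)) /
        Nat.card (MulAction.stabilizer SL(2, ℤ) s) =
      ∑ᶠ x, φ (rep x) / stabOrder N (rep x) := by
  classical
  let P (s : ℍ) (q : SL(2, ℤ) ⧸ Gamma0 N) : OpenModularCurve N := Quotient.mk _ (q.out⁻¹ • s)
  have hP {s : ℍ} {q : SL(2, ℤ) ⧸ Gamma0 N} {x : OpenModularCurve N} :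
      P s q = x ↔ ∃ h ∈ Gamma0 N, q.out⁻¹ • s = h • rep x := by
    nth_rewrite 1 [← hrep x]
    rw [Quotient.eq, MulAction.orbitRel_apply, MulAction.mem_orbit_iff]
    constructor
    · rintro ⟨⟨h, hh⟩, e⟩
      exact ⟨h, hh, e.symm⟩
    · rintro ⟨h, hh, e⟩
      exact ⟨⟨h, hh⟩, e.symm⟩
  let A : Finset (OpenModularCurve N) := (S ×ˢ Finset.univ).image fun p ↦ P p.1 p.2
  have hA : support (fun x ↦ φ (rep x)) ⊆ A := by
    intro x hx
    obtain ⟨s, hs, γ, hγ⟩ := hcov (rep x) hx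
    obtain ⟨h, hh⟩ := QuotientGroup.mk_out_eq_mul (Gamma0 N) γ⁻¹
    refine Finset.mem_coe.mpr (Finset.mem_image.mpr ⟨(s, (γ⁻¹ : SL(2, ℤ))), by simp [hs], ?_⟩)
    refine hP.mpr ⟨(h : SL(2, ℤ))⁻¹, inv_mem h.2, ?_⟩
    rw [hh, hγ, mul_inv_rev, inv_inv, mul_smul]
  refine ⟨A.finite_toSet.subset hA, ?_⟩
  rw [finsum_eq_sum_of_support_subset (s := A) _ 
    (Set.Subset.trans (fun x hx ↦ fun h ↦ hx (by simp [h])) hA)]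
  have hexp (s : ℍ) (hs : s ∈ S) : 2 * (∑ q : SL(2, ℤ) ⧸ Gamma0 N, φ (q.out⁻¹ • s)) /
      Nat.card (MulAction.stabilizer SL(2, ℤ) s) = ∑ x ∈ A, ∑ q : SL(2, ℤ) ⧸ Gamma0 N,
        if P s q = x then 2 * φ (rep x) / Nat.card (MulAction.stabilizer SL(2, ℤ) s) else 0 := by
    rw [Finset.sum_comm, Finset.mul_sum, Finset.sum_div]
    refine Finset.sum_congr rfl fun q _ ↦ ?_
    have hmem : P s q ∈ A := Finset.mem_image.mpr ⟨(s, q), by simp [hs], rfl⟩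
    rw [Finset.sum_ite_eq, if_pos hmem]
    obtain ⟨h, hh, e⟩ := hP.mp (rfl : P s q = P s q)
    rw [e, hφ h hh]
  rw [Finset.sum_congr rfl hexp, Finset.sum_comm]
  refine Finset.sum_congr rfl fun x hx ↦ ?_
  obtain ⟨⟨s, q₀⟩, hsq, hx⟩ := Finset.mem_image.mp hx
  have hs : s ∈ S := (Finset.mem_product.mp hsq).1
  obtain ⟨h, hh, e⟩ := hP.mp hx
  have hγ : s = (q₀.out * h) • rep x := by rw [mul_smul, ← e, smul_inv_smul]
  rw [Finset.sum_eq_single_of_mem s hs]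
  · rw [← Finset.sum_filter, Finset.sum_const, nsmul_eq_mul]
    -- The number of cosets over `x`, divided by half the stabilizer of `s`, is exactly `1 /
    -- stabOrder N (rep x)`.
    have hcount := ncard_cosets_mul_card_stabilizer (Gamma0 N) hγ
    have hset : {q : SL(2, ℤ) ⧸ Gamma0 N | ∃ h ∈ Gamma0 N, q.out⁻¹ • s = h • rep x} =
        ((Finset.univ.filter fun q ↦ P s q = x : Finset _) : Set (SL(2, ℤ) ⧸ Gamma0 N)) := by
      ext q
      simp [hP]
    rw [hset, Set.ncard_coe_finset, card_stabilizer_Gamma0] at hcount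
    obtain ⟨e, -, he, hcard, -⟩ := exists_orderAt_kleinJ s
    have hpos : Nat.card (MulAction.stabilizer SL(2, ℤ) s) ≠ 0 := by omega
    rw [← hcount] at hpos ⊢
    push_cast
    have h1 : ((Finset.univ.filter fun q ↦ P s q = x).card : ℝ) ≠ 0 := by
      exact_mod_cast left_ne_zero_of_mul hpos
    have h2 : (stabOrder N (rep x) : ℝ) ≠ 0 := by
      exact_mod_cast right_ne_zero_of_mul (right_ne_zero_of_mul hpos)
    field_simp
  · intro t ht hts
    refine Finset.sum_eq_zero fun q _ ↦ if_neg fun hq ↦ hts (hinj ht hs ?_)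
    obtain ⟨h', -, e'⟩ := hP.mp hq
    rw [hγ, kleinJ_smul, ← kleinJ_smul h' (rep x), ← e', kleinJ_smul]

lemma IsMeromorphicModularForm.sum_cosets_cuspOrder [Fintype (SL(2, ℤ) ⧸ Gamma0 N)]
    (hf : IsMeromorphicModularForm N k f) (hf0 : IsNonzero f) (hN : 0 < N)
    {σ : CuspSet N → SL(2, ℤ)} (hσ : ∀ ρ, cuspOf N (σ ρ) = ρ) :
    ∑ q : SL(2, ℤ) ⧸ Gamma0 N, (ordAtCusp N k f q.out⁻¹ / cuspWidth N q.out⁻¹ : ℝ) =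
      ∑ᶠ ρ, (ordAtCusp N k f (σ ρ) : ℝ) := by
  classical
  have := finite_cuspSet hN
  have := Fintype.ofFinite (CuspSet N)
  rw [finsum_eq_sum_of_fintype, ← Finset.sum_fiberwise Finset.univ
    (fun q : SL(2, ℤ) ⧸ Gamma0 N ↦ cuspOf N q.out⁻¹)]
  refine Finset.sum_congr rfl fun ρ _ ↦ ?_
  have hcount := ncard_setOf_cuspOf_eq hN (σ ρ)
  have hset : {q : SL(2, ℤ) ⧸ Gamma0 N | cuspOf N q.out⁻¹ = cuspOf N (σ ρ)} =
      ((Finset.univ.filter fun q : SL(2, ℤ) ⧸ Gamma0 N ↦ cuspOf N q.out⁻¹ = ρ : Finset _) :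
        Set (SL(2, ℤ) ⧸ Gamma0 N)) := by
    ext q
    simp [hσ]
  rw [hset, Set.ncard_coe_finset] at hcount
  have hw : (cuspWidth N (σ ρ) : ℝ) ≠ 0 := by exact_mod_cast (cuspWidth_pos hN (σ ρ)).ne'
  rw [Finset.sum_congr rfl fun q hq ↦ hf.cuspOrder_eq hf0 hN
    ((Finset.mem_filter.mp hq).2.trans (hσ ρ).symm), Finset.sum_const, hcount, nsmul_eq_mul]
  field_simp

/-- The valence formula for meromorphic modular forms on `Γ₀(N)`. -/
theorem IsMeromorphicModularForm.valence_formula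
    (hf : IsMeromorphicModularForm N k f) (hf0 : IsNonzero f) (hN : 0 < N)
    {rep : OpenModularCurve N → ℍ} (hrep : ∀ x, Quotient.mk _ (rep x) = x)
    {σ : CuspSet N → SL(2, ℤ)} (hσ : ∀ ρ, cuspOf N (σ ρ) = ρ) :
    {x | ordAt f (rep x) ≠ 0}.Finite ∧
      (∑ᶠ x, (ordAt f (rep x) : ℝ) / stabOrder N (rep x)) +
        ∑ᶠ ρ, (ordAtCusp N k f (σ ρ) : ℝ) = k / 12 * (Gamma0 N).index := by
  classical
  have : NeZero N := ⟨hN.ne'⟩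
  have := Fintype.ofFinite (SL(2, ℤ) ⧸ Gamma0 N)
  have htop := orderAt_ne_top hf.meromorphic hf0
  have hord (z : ℍ) : orderAt f z = ordAt f z := (WithTop.coe_untop₀_of_ne_top (htop z)).symm
  have hord0 {z : ℍ} : ordAt f z ≠ 0 ↔ orderAt f z ≠ 0 := by
    rw [hord]
    norm_cast
  set t : SL(2, ℤ) ⧸ Gamma0 N → ℍ → ℂ := fun q ↦ f ∣[k] q.out⁻¹ with ht
  have htm (q : SL(2, ℤ) ⧸ Gamma0 N) (z : ℍ) := hf.meromorphicAt_slash q.out⁻¹ z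
  have hto (q : SL(2, ℤ) ⧸ Gamma0 N) (z : ℍ) : orderAt (t q) z = orderAt f (q.out⁻¹ • z) :=
    hf.orderAt_slash _ z
  have htc (q : SL(2, ℤ) ⧸ Gamma0 N) := hf.hasCuspOrder_slash hf0 hN q.out⁻¹
  -- Each translate has no zeros or poles high up, and the rest of `𝒟` is compact.
  have hW : {w | w ∈ 𝒟 ∧ ∃ q, orderAt (t q) w ≠ 0}.Finite := by
    have hq (q : SL(2, ℤ) ⧸ Gamma0 N) : {w | w ∈ 𝒟 ∧ orderAt (t q) w ≠ 0}.Finite := by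
      obtain ⟨B, hB⟩ := (htc q).exists_orderAt_eq_zero (htm q)
      refine (finite_setOf_orderAt_ne_zero (htm q) (fun z ↦ by rw [hto]; exact htop _)
        (ModularGroup.isCompact_truncatedFundamentalDomain B)).subset ?_
      rintro w ⟨hw, h0⟩
      exact ⟨⟨hw, le_of_not_ge fun h ↦ h0 (hB w h)⟩, h0⟩
    refine (Set.finite_iUnion hq).subset ?_
    rintro w ⟨hw, q, h0⟩
    exact Set.mem_iUnion.mpr ⟨q, hw, h0⟩
  -- Keeping one point for each value of `j` keeps one for each orbit.
  obtain ⟨S', hS', hbij⟩ := Set.exists_subset_bijOn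
    {w | w ∈ 𝒟 ∧ ∃ q, orderAt (t q) w ≠ 0} kleinJ
  set S : Finset ℍ := (hW.subset hS').toFinset with hS
  have hinj : Set.InjOn kleinJ S := by simpa [hS] using hbij.injOn
  have hcov (y : ℍ) (hy : orderAt f y ≠ 0) : ∃ s ∈ S, ∃ γ : SL(2, ℤ), y = γ • s := by
    obtain ⟨γ, hγ⟩ := ModularGroup.exists_smul_mem_fd y
    obtain ⟨h, hh⟩ := QuotientGroup.mk_out_eq_mul (Gamma0 N) γ
    have hmem : γ • y ∈ {w | w ∈ 𝒟 ∧ ∃ q, orderAt (t q) w ≠ 0} := by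
      refine ⟨hγ, γ, ?_⟩
      rwa [hto, hh, mul_inv_rev, mul_smul, inv_smul_smul, hf.orderAt_smul (inv_mem h.2)]
    obtain ⟨s, hs, e⟩ := hbij.surjOn (Set.mem_image_of_mem kleinJ hmem)
    rw [kleinJ_smul] at e
    exact ⟨s, by simpa [hS] using hs, exists_smul_eq_of_kleinJ_eq e⟩
  set F : ℍ → ℂ := fun τ ↦ ∏ q, t q τ with hF
  have hFprod : F = ∏ q, t q := by
    ext τ
    simp [hF]
  have hFo (z : ℍ) : orderAt F z = ∑ q : SL(2, ℤ) ⧸ Gamma0 N, orderAt f (q.out⁻¹ • z) := by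
    rw [hF, orderAt_prod fun q ↦ htm q z]
    exact Finset.sum_congr rfl fun q _ ↦ hto q z
  have hFo' (z : ℍ) : orderAt F z = (∑ q : SL(2, ℤ) ⧸ Gamma0 N, ordAt f (q.out⁻¹ • z) : ℤ) := by
    rw [hFo, WithTop.coe_sum]
    exact Finset.sum_congr rfl fun q _ ↦ hord _
  have hFslash (γ : SL(2, ℤ)) : F ∣[k * (Gamma0 N).index] γ = F := by
    have hcard : (Gamma0 N).index = (Finset.univ : Finset (SL(2, ℤ) ⧸ Gamma0 N)).card := by
      rw [Subgroup.index_eq_card, Nat.card_eq_fintype_card, Finset.card_univ]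
    rw [hFprod, hcard, ModularForm.SL_slash, ModularForm.prod_slash]
    have hone : |(γ : GL (Fin 2) ℝ).det.val| = 1 := by simp
    rw [hone, one_zpow, one_smul]
    -- Slashing by `γ` turns the factor at `q` into the one at `γ⁻¹ • q`, so the factors are merely
    -- permuted.
    refine (Finset.prod_congr rfl fun q _ ↦ ?_).trans
      (Equiv.prod_comp (MulAction.toPerm (γ⁻¹ : SL(2, ℤ))) t)
    rw [ht, MulAction.toPerm_apply, ← ModularForm.SL_slash, ← SlashAction.slash_mul]
    have := hf.slash_inv_eq_of_mk_eq (g := γ⁻¹ * q.out) (g' := (γ⁻¹ • q).out) (by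
      rw [QuotientGroup.out_eq', ← smul_eq_mul, ← MulAction.Quotient.smul_coe,
        QuotientGroup.out_eq'])
    simpa using this
  have hmain := valence_formula_levelOne hFslash
    (fun z ↦ MeromorphicAt.fun_prod (F := fun q ↦ t q ∘ ofComplex) fun q _ ↦ htm q z)
    (fun z ↦ by rw [hFo']; exact WithTop.coe_ne_top) (HasCuspOrder.prod fun q _ ↦ htc q) S hinj
    (fun z hz ↦ by
      rw [hFo] at hz
      obtain ⟨q, -, hq⟩ := Finset.exists_ne_zero_of_sum_ne_zero hz
      obtain ⟨s, hs, γ, e⟩ := hcov _ hq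
      exact ⟨s, hs, q.out * γ, by rw [mul_smul, ← e, smul_inv_smul]⟩)
  obtain ⟨hfin, hsum⟩ := finite_and_sum_cosets_eq_finsum (N := N) (φ := fun z ↦ (ordAt f z : ℝ))
    (fun γ hγ z ↦ by rw [ordAt_eq_of_orderAt_eq (hf.orderAt_smul hγ z)]) hinj
    (fun y hy ↦ hcov y (hord0.mp (by exact_mod_cast hy))) hrep
  refine ⟨by simpa using hfin, ?_⟩
  rw [← hsum, ← hf.sum_cosets_cuspOrder hf0 hN hσ]
  have hFord (s : ℍ) : (ordAt F s : ℝ) =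
      ∑ q : SL(2, ℤ) ⧸ Gamma0 N, (ordAt f (q.out⁻¹ • s) : ℝ) := by
    rw [ordAt, show meromorphicOrderAt (F ∘ ofComplex) (s : ℂ) = _ from hFo' s,
      WithTop.untop₀_coe, Int.cast_sum]
  simp only [hFord] at hmain
  rw [hmain]
  push_cast
  ring

end ModularForms

/-! ### The hyperbolic area. -/

section Volume

open MeasureTheory

lemma arcsin_one_half : Real.arcsin (1 / 2) = π / 6 :=
  Real.arcsin_eq_of_sin_eq Real.sin_pi_div_six ⟨by linarith [Real.pi_pos], by linarith [Real.pi_pos]⟩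

lemma integral_one_div_sqrt_one_sub_sq :
    ∫ x in (-(1 / 2) : ℝ)..1 / 2, 1 / √(1 - x ^ 2) = π / 3 := by
  have hmem {x : ℝ} (hx : x ∈ Set.uIcc (-(1 / 2) : ℝ) (1 / 2)) : 0 < 1 - x ^ 2 := by
    rw [Set.uIcc_of_le (by norm_num)] at hx
    nlinarith [hx.1, hx.2]
  rw [intervalIntegral.integral_eq_sub_of_hasDerivAt (f := Real.arcsin)]
  · rw [Real.arcsin_neg, arcsin_one_half]
    ring
  · intro x hx
    have := hmem hx
    exact Real.hasDerivAt_arcsin (fun h ↦ by rw [h] at this; norm_num at this)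
      (fun h ↦ by rw [h] at this; norm_num at this)
  · refine ContinuousOn.intervalIntegrable fun x hx ↦ ContinuousAt.continuousWithinAt ?_
    have := (Real.sqrt_pos.mpr (hmem hx)).ne'
    fun_prop (disch := assumption)

lemma lintegral_Ioi_inv_sq {c : ℝ} (hc : 0 < c) :
    ∫⁻ y in Set.Ioi c, (((1 / ‖y‖₊) ^ 2 : NNReal) : ENNReal) = ENNReal.ofReal (1 / c) := by
  have h1 := integral_Ioi_rpow_of_lt (a := -2) (by norm_num) hc
  have h2 := integrableOn_Ioi_rpow_of_lt (a := -2) (by norm_num) hc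
  have h3 := ofReal_integral_eq_lintegral_ofReal h2
    ((ae_restrict_mem measurableSet_Ioi).mono fun y hy ↦ Real.rpow_nonneg (hc.trans hy).le _)
  rw [h1] at h3
  rw [show 1 / c = -c ^ (-2 + 1 : ℝ) / (-2 + 1) by
    rw [show (-2 + 1 : ℝ) = -1 by norm_num, Real.rpow_neg_one]; ring, h3]
  refine setLIntegral_congr_fun measurableSet_Ioi fun y hy ↦ ?_
  have hy0 : 0 < y := hc.trans hy
  rw [← ENNReal.ofReal_coe_nnreal]
  congr 1
  rw [Real.rpow_neg hy0.le]
  simp [abs_of_pos hy0]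

lemma coe_image_fdo : UpperHalfPlane.coe '' 𝒟ᵒ = Complex.measurableEquivRealProd ⁻¹'
    {p : ℝ × ℝ | p.1 ∈ Set.Ioo (-(1 / 2)) (1 / 2) ∧ p.2 ∈ Set.Ioi √(1 - p.1 ^ 2)} := by
  rw [ModularGroup.coe_fdo]
  ext z
  simp only [Set.mem_preimage, Complex.measurableEquivRealProd_apply, Set.mem_ofPred_eq,
    Set.mem_Ioo, Set.mem_Ioi, ← abs_lt]
  have hn : 1 < ‖z‖ ↔ 1 < z.re ^ 2 + z.im ^ 2 := by
    rw [← one_lt_sq_iff₀ (norm_nonneg z), Complex.sq_norm, Complex.normSq_apply, sq, sq]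
  rw [hn]
  constructor
  · rintro ⟨h1, h2, h3⟩
    exact ⟨h3, (Real.sqrt_lt' h1).mpr (by linarith)⟩
  · rintro ⟨h3, h2⟩
    have h1 := (Real.sqrt_nonneg _).trans_lt h2
    exact ⟨h1, by linarith [(Real.sqrt_lt' h1).mp h2], h3⟩

/-- The hyperbolic area of the standard fundamental domain. -/
theorem volume_fdo : volume 𝒟ᵒ = ENNReal.ofReal (π / 3) := by
  set A : Set (ℝ × ℝ) :=
    {p | p.1 ∈ Set.Ioo (-(1 / 2)) (1 / 2) ∧ p.2 ∈ Set.Ioi √(1 - p.1 ^ 2)} with hA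
  have hAm : MeasurableSet A := by
    refine (measurableSet_Ioo.preimage measurable_fst).inter ?_
    exact measurableSet_lt (by fun_prop) measurable_snd
  have hg : Measurable fun p : ℝ × ℝ ↦ (((1 / ‖p.2‖₊) ^ 2 : NNReal) : ENNReal) := by fun_prop
  rw [UpperHalfPlane.volume_eq_lintegral, coe_image_fdo]
  refine (Complex.volume_preserving_equiv_real_prod.setLIntegral_comp_preimage hAm hg).trans ?_
  rw [← lintegral_indicator hAm, Measure.volume_eq_prod, lintegral_prod _
      (hg.indicator hAm).aemeasurable]
  have hinner (x : ℝ) : ∫⁻ y, A.indicator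
        (fun p : ℝ × ℝ ↦ (((1 / ‖p.2‖₊) ^ 2 : NNReal) : ENNReal)) (x, y) =
      (Set.Ioo (-(1 / 2)) (1 / 2)).indicator
        (fun x ↦ ENNReal.ofReal (1 / √(1 - x ^ 2))) x := by
    by_cases hx : x ∈ Set.Ioo (-(1 / 2) : ℝ) (1 / 2)
    · have h0 : 0 < √(1 - x ^ 2) := Real.sqrt_pos.mpr (by nlinarith [hx.1, hx.2])
      rw [Set.indicator_of_mem hx, ← lintegral_Ioi_inv_sq h0,
        ← lintegral_indicator measurableSet_Ioi]
      refine lintegral_congr fun y ↦ ?_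
      by_cases hy : y ∈ Set.Ioi √(1 - x ^ 2)
      · rw [Set.indicator_of_mem hy, Set.indicator_of_mem (show (x, y) ∈ A from ⟨hx, hy⟩)]
      · rw [Set.indicator_of_notMem hy, Set.indicator_of_notMem (fun h : (x, y) ∈ A ↦ hy h.2)]
    · rw [Set.indicator_of_notMem hx]
      refine (lintegral_congr fun y ↦ ?_).trans lintegral_zero
      exact Set.indicator_of_notMem (fun h : (x, y) ∈ A ↦ hx h.1) _
  rw [lintegral_congr hinner, lintegral_indicator measurableSet_Ioo,
    ← integral_one_div_sqrt_one_sub_sq, intervalIntegral.integral_of_le (by norm_num),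
    ← restrict_Ioo_eq_restrict_Ioc]
  refine (ofReal_integral_eq_lintegral_ofReal ?_ (ae_of_all _ fun x ↦ by positivity)).symm
  have hc : ContinuousOn (fun x : ℝ ↦ 1 / √(1 - x ^ 2)) (Set.Icc (-(1 / 2)) (1 / 2)) := by
    refine fun x hx ↦ ContinuousAt.continuousWithinAt ?_
    have h0 : √(1 - x ^ 2) ≠ 0 := (Real.sqrt_pos.mpr (by nlinarith [hx.1, hx.2])).ne'
    fun_prop (disch := assumption)
  exact (hc.integrableOn_compact isCompact_Icc).mono_set Set.Ioo_subset_Icc_self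

lemma volume_setOf_re_eq (c : ℝ) : volume {z : ℂ | z.re = c} = 0 := by
  have : {z : ℂ | z.re = c} = Complex.measurableEquivRealProd ⁻¹' ({c} ×ˢ Set.univ) := by
    ext z
    simp
  rw [this, Complex.volume_preserving_equiv_real_prod.measure_preimage_equiv,
    Measure.volume_eq_prod, Measure.prod_prod]
  simp

lemma volume_fd_diff_fdo : volume (𝒟 \ 𝒟ᵒ) = 0 := by
  rw [UpperHalfPlane.volume_eq_lintegral]
  refine setLIntegral_measure_zero _ _ (measure_mono_null (t := Metric.sphere (0 : ℂ) 1 ∪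
    ({z : ℂ | z.re = 1 / 2} ∪ {z : ℂ | z.re = -(1 / 2)})) ?_ ?_)
  · rintro _ ⟨z, ⟨⟨h1, h2⟩, h3⟩, rfl⟩
    rcases h1.eq_or_lt with h1 | h1
    · left
      rw [mem_sphere_zero_iff_norm, ← sq_eq_sq₀ (norm_nonneg _) zero_le_one, Complex.sq_norm,
        ← h1, one_pow]
    · right
      rcases h2.eq_or_lt with h2 | h2
      · exact (abs_eq (by norm_num)).mp h2
      · exact absurd ⟨h1, h2⟩ h3
  · rw [measure_union_null_iff, measure_union_null_iff]
    exact ⟨Measure.addHaar_sphere _ _ _, volume_setOf_re_eq _, volume_setOf_re_eq _⟩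

lemma measurePreserving_SL2Z_smul (γ : SL(2, ℤ)) :
    MeasurePreserving (fun z : ℍ ↦ γ • z) volume volume :=
  measurePreserving_smul (γ : GL (Fin 2) ℝ) (volume : Measure ℍ)

variable {N : ℕ}

lemma toPGLReal_mem {γ : SL(2, ℤ)} (hγ : γ ∈ Gamma0 N) : toPGLReal γ ∈ Gamma0Bar N :=
  Subgroup.mem_map_of_mem _ hγ

lemma exists_Gamma0Bar_smul_eq (g : Gamma0Bar N) :
    ∃ h ∈ Gamma0 N, toPGLReal h = g ∧ ∀ z : ℍ, g • z = h • z := by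
  obtain ⟨g, hg⟩ := g
  obtain ⟨h, hh, rfl⟩ := Subgroup.mem_map.mp hg
  exact ⟨h, hh, rfl, fun z ↦ toPGLReal_smul h z⟩

instance : Countable SL(2, ℤ) :=
  Function.Injective.countable (f := fun g : SL(2, ℤ) ↦ fun i j ↦ g i j)
    fun _ _ h ↦ Matrix.SpecialLinearGroup.ext _ _ fun i j ↦ congrFun₂ h i j

instance : Countable (Gamma0Bar N) := by
  refine Function.Surjective.countable (f := fun h : Gamma0 N ↦
    (⟨toPGLReal h, toPGLReal_mem h.2⟩ : Gamma0Bar N)) fun g ↦ ?_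
  obtain ⟨h, hh, e, -⟩ := exists_Gamma0Bar_smul_eq g
  exact ⟨⟨h, hh⟩, Subtype.ext e⟩

lemma measurePreserving_Gamma0Bar_smul (g : Gamma0Bar N) :
    MeasurePreserving (fun z : ℍ ↦ g • z) volume volume := by
  obtain ⟨h, -, -, e⟩ := exists_Gamma0Bar_smul_eq g
  simp only [e]
  exact measurePreserving_SL2Z_smul h

instance : MeasurableConstSMul (Gamma0Bar N) ℍ :=
  ⟨fun g ↦ (measurePreserving_Gamma0Bar_smul g).measurable⟩

instance : SMulInvariantMeasure (Gamma0Bar N) ℍ volume :=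
  ⟨fun g _ hs ↦ (measurePreserving_Gamma0Bar_smul g).measure_preimage hs.nullMeasurableSet⟩

lemma measurableSet_fdo : MeasurableSet 𝒟ᵒ := ModularGroup.isOpen_fdo.measurableSet

/-- A fundamental domain for `Γ₀(N)`, assembled from translates of the standard one. -/
def fundamentalDomain (N : ℕ) : Set ℍ :=
  ⋃ q : SL(2, ℤ) ⧸ Gamma0 N, (fun z : ℍ ↦ q.out • z) ⁻¹' 𝒟ᵒ

lemma measurableSet_preimage_fdo (γ : SL(2, ℤ)) :
    MeasurableSet ((fun z : ℍ ↦ γ • z) ⁻¹' 𝒟ᵒ) :=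
  (measurePreserving_SL2Z_smul γ).measurable measurableSet_fdo

lemma measurableSet_fundamentalDomain (hN : 0 < N) : MeasurableSet (fundamentalDomain N) := by
  have : NeZero N := ⟨hN.ne'⟩
  exact MeasurableSet.iUnion fun q ↦ measurableSet_preimage_fdo q.out

lemma eq_or_eq_neg_of_smul_mem_fdo {g g' : SL(2, ℤ)} {z : ℍ} (h : g • z ∈ 𝒟ᵒ)
    (h' : g' • z ∈ 𝒟ᵒ) : g' = g ∨ g' = -g := by
  have := ModularGroup.eq_one_or_neg_one_of_mem_fdo_mem_fdo (g := g' * g⁻¹) h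
    (by rwa [mul_smul, inv_smul_smul])
  refine this.imp mul_inv_eq_one.mp fun e ↦ ?_
  rw [mul_inv_eq_iff_eq_mul] at e
  simpa using e

/-- The two elements agree up to sign, and `-1 ∈ Γ₀(N)`. This makes the translates indexed by cosets
disjoint. -/
lemma mk_eq_of_smul_mem_fdo {g g' : SL(2, ℤ)} {z : ℍ} (h : g • z ∈ 𝒟ᵒ) (h' : g' • z ∈ 𝒟ᵒ) :
    (g : SL(2, ℤ) ⧸ Gamma0 N) = g' := by
  rw [QuotientGroup.eq]
  rcases eq_or_eq_neg_of_smul_mem_fdo h h' with rfl | rfl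
  · simp
  · simp

/-- Every point has a translate in `𝒟`; the exceptions lie in countably many translates of the null
boundary. -/
lemma ae_exists_smul_mem_fdo : ∀ᵐ z : ℍ, ∃ γ : SL(2, ℤ), γ • z ∈ 𝒟ᵒ := by
  have hae : ∀ᵐ z : ℍ, ∀ γ : SL(2, ℤ), γ • z ∉ 𝒟 \ 𝒟ᵒ := by
    rw [ae_all_iff]
    intro γ
    have := (measurePreserving_SL2Z_smul γ).quasiMeasurePreserving.preimage_null volume_fd_diff_fdo
    exact measure_eq_zero_iff_ae_notMem.mp this
  filter_upwards [hae] with z hz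
  obtain ⟨γ, hγ⟩ := ModularGroup.exists_smul_mem_fd z
  refine ⟨γ, ?_⟩
  by_contra h
  exact hz γ ⟨hγ, h⟩

lemma exists_smul_mem_fundamentalDomain {z : ℍ} {γ : SL(2, ℤ)} (hγ : γ • z ∈ 𝒟ᵒ) :
    ∃ g : Gamma0Bar N, g • z ∈ fundamentalDomain N := by
  obtain ⟨h, hh⟩ := QuotientGroup.mk_out_eq_mul (Gamma0 N) γ
  refine ⟨⟨toPGLReal (h : SL(2, ℤ))⁻¹, toPGLReal_mem (inv_mem h.2)⟩, ?_⟩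
  refine Set.mem_iUnion.mpr ⟨γ, ?_⟩
  rw [Set.mem_preimage, Subgroup.mk_smul, toPGLReal_smul, hh, mul_smul, smul_inv_smul]
  exact hγ

lemma eq_one_of_smul_mem_fundamentalDomain {g : Gamma0Bar N} {z : ℍ}
    (hz : z ∈ fundamentalDomain N) (hgz : g • z ∈ fundamentalDomain N) : g = 1 := by
  obtain ⟨q, hq⟩ := Set.mem_iUnion.mp hgz
  obtain ⟨q', hq'⟩ := Set.mem_iUnion.mp hz
  obtain ⟨h, hh, e, hsmul⟩ := exists_Gamma0Bar_smul_eq g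
  rw [Set.mem_preimage] at hq hq'
  rw [hsmul, ← mul_smul] at hq
  have hqq : q = q' := by
    have := mk_eq_of_smul_mem_fdo (N := N) hq hq'
    rwa [QuotientGroup.mk_mul_of_mem _ hh, QuotientGroup.out_eq', QuotientGroup.out_eq'] at this
  subst hqq
  have h1 : toPGLReal h = 1 := by
    rw [toPGLReal_eq_one_iff]
    refine (eq_or_eq_neg_of_smul_mem_fdo hq' hq).imp mul_eq_left.mp fun h ↦ ?_
    rw [← mul_neg_one] at h
    exact mul_left_cancel h
  rw [h1] at e
  exact Subtype.ext e.symm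

lemma isFundamentalDomain (hN : 0 < N) :
    IsFundamentalDomain (Gamma0Bar N) (fundamentalDomain N) volume := by
  refine IsFundamentalDomain.mk'' (measurableSet_fundamentalDomain hN).nullMeasurableSet
    (ae_exists_smul_mem_fdo.mono fun z ⟨γ, hγ⟩ ↦ exists_smul_mem_fundamentalDomain hγ) ?_
    fun g ↦ (measurePreserving_Gamma0Bar_smul g).quasiMeasurePreserving
  intro g hg
  refine Disjoint.aedisjoint (Set.disjoint_left.mpr fun z hz hz' ↦ hg ?_)
  rw [Set.mem_smul_set_iff_inv_smul_mem] at hz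
  have := eq_one_of_smul_mem_fundamentalDomain hz' hz
  exact inv_eq_one.mp this

/-- The hyperbolic area of the modular curve of level `N`. -/
theorem hyperbolicVol_eq (hN : 0 < N) : hyperbolicVol N = (Gamma0 N).index * (π / 3) := by
  have : NeZero N := ⟨hN.ne'⟩
  have := Fintype.ofFinite (SL(2, ℤ) ⧸ Gamma0 N)
  rw [hyperbolicVol, (isFundamentalDomain hN).covolume_eq_volume, fundamentalDomain,
    measure_iUnion, tsum_fintype]
  · simp_rw [(measurePreserving_SL2Z_smul _).measure_preimage measurableSet_fdo.nullMeasurableSet]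
    rw [Finset.sum_const, volume_fdo, Finset.card_univ, nsmul_eq_mul, ENNReal.toReal_mul,
      ENNReal.toReal_ofReal (by positivity), ENNReal.toReal_natCast, Subgroup.index_eq_card,
      Nat.card_eq_fintype_card]
  · intro q q' hqq
    refine Set.disjoint_left.mpr fun z hz hz' ↦ hqq ?_
    simpa using mk_eq_of_smul_mem_fdo (N := N) hz hz'
  · exact fun q ↦ measurableSet_preimage_fdo q.out

end Volume

end ValenceFormula

end

theorem mainTheorem2 (N : ℕ) (hN : 0 < N) (k : ℤ) (f : ℍ → ℂ)
    (hf : IsMeromorphicModularForm N k f) (hf0 : IsNonzero f)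
    -- an arbitrary representative of each orbit, and an arbitrary scaling matrix for each cusp
    (rep : OpenModularCurve N → ℍ) (hrep : ∀ x, Quotient.mk _ (rep x) = x)
    (σ : CuspSet N → SL(2, ℤ)) (hσ : ∀ ρ, cuspOf N (σ ρ) = ρ) :
    {x : OpenModularCurve N | ordAt f (rep x) ≠ 0}.Finite ∧
    Finite (CuspSet N) ∧
    (∑ᶠ x : OpenModularCurve N, (ordAt f (rep x) : ℝ) / (stabOrder N (rep x) : ℝ)) +
        ∑ᶠ ρ : CuspSet N, (ordAtCusp N k f (σ ρ) : ℝ) =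
      (k : ℝ) / 2 * (hyperbolicVol N / (2 * π)) ∧
    (k : ℝ) / 2 * (hyperbolicVol N / (2 * π)) = (k : ℝ) / 12 * ((Gamma0 N).index : ℝ) := by
  obtain ⟨hfin, hsum⟩ := hf.valence_formula hf0 hN hrep hσ
  have hvol : (k : ℝ) / 2 * (hyperbolicVol N / (2 * π)) =
      (k : ℝ) / 12 * ((Gamma0 N).index : ℝ) := by
    rw [hyperbolicVol_eq hN]
    field_simp
    ring
  exact ⟨hfin, finite_cuspSet hN, hsum.trans hvol.symm, hvol⟩
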